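/- Let $p\ge 1$ and $m\ge 2p$ be integers. Let $W\sim W_p(m)$ be a standard Wishart matrix, i.e. a random $p\times p$ matrix with the law of $\sum_{i=1}^m \boldsymbol X_i\boldsymbol X_i^\top$, where $\boldsymbol X_1,\dots,\boldsymbol X_m$ are i.i.d. $\mathcal N_p(\boldsymbol 0,I_p)$ random vectors, and let $W^{1/2}$ be its symmetric positive (semi)definite square root. For a $p\times p$ matrix $G=(g_{ij})$ write $G_{up}=(g_{11},\dots,g_{pp},g_{12},\dots,g_{1p},\dots,g_{p-1,p})^\top\in\mathbb R^{p(p+1)/2}$. Let $$\boldsymbol Z'\sim\mathcal N_{p(p+1)/2}\left(\boldsymbol 0,\begin{pmatrix}\frac12 I_p&0\\0&\frac14 I_{p(p-1)/2}\end{pmatrix}\right).$$ For integrable random vectors $\boldsymbol X,\boldsymbol Y$ in $\mathbb R^d$ let $d_W(\boldsymbol X,\boldsymbol Y)=\sup_{h}\left|\mathbb E[h(\boldsymbol X)]-\mathbb E[h(\boldsymbol Y)]\right|$ be the 1-Wasserstein distance, where the supremum is over all functions $h:\mathbb R^d\to\mathbb R$ that are $1$-Lipschitz for the Euclidean norm.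 Then $(W^{1/2}-\sqrt m\,I)_{up}$ and $\boldsymbol Z'$ are integrable, and $$d_W\left(\left(W^{1/2}-\sqrt m\,I\right)_{up},\boldsymbol Z'\right)<\frac{1}{\sqrt m}\left(42p^{5/2}+9p^{9/4}+18p^2+75p^{3/2}+15p^{5/4}+56p\right).$$ Moreover, the right-hand side is $O(p^{5/2}/\sqrt m)$: there is an absolute constant $C>0$ such that it is at most $C\,p^{5/2}/\sqrt m$ for all integers $p\ge1$ and $m\ge 2p$. -/

import Mathlib

open MeasureTheory ProbabilityTheory
open scoped MatrixOrder ENNReal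

noncomputable section

/-- The entrywise (product) σ-algebra on real matrices, which is also the Borel σ-algebra. -/
instance matrixMeasurableSpace (p : ℕ) : MeasurableSpace (Matrix (Fin p) (Fin p) ℝ) :=
  inferInstanceAs (MeasurableSpace (Fin p → Fin p → ℝ))

/-- The Wishart distribution `W_p(m, S)`: the law of `∑ i, X i * (X i)ᵀ`, where `X 1, …, X m` are
i.i.d. random vectors in `ℝ^p` with law `N_p(0, S)`. -/
def wishartLaw (p m : ℕ) (S : Matrix (Fin p) (Fin p) ℝ) :
    Measure (Matrix (Fin p) (Fin p) ℝ) :=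
  (Measure.pi fun _ : Fin m ↦ multivariateGaussian (0 : EuclideanSpace ℝ (Fin p)) S).map
    fun X ↦ ∑ i, Matrix.vecMulVec (X i).ofLp (X i).ofLp

/-- The standard Wishart distribution `W_p(m) = W_p(m, I_p)`. -/
def stdWishartLaw (p m : ℕ) : Measure (Matrix (Fin p) (Fin p) ℝ) :=
  wishartLaw p m 1

/-- The positions strictly above the diagonal of a `p × p` matrix. -/
abbrev AboveDiag (p : ℕ) : Type := {ij : Fin p × Fin p // ij.1 < ij.2}

/-- Index set of the coordinates of the upper triangular part of a `p × p` matrix: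
first the `p` diagonal positions, then the `p (p - 1) / 2` positions above the diagonal. -/
abbrev UpIndex (p : ℕ) : Type := Fin p ⊕ AboveDiag p

/-- The vector `G_up = (g₁₁, …, g_pp, g₁₂, …, g₁p, …, g_{p-1,p})`, in Euclidean space. -/
def upVec {p : ℕ} (G : Matrix (Fin p) (Fin p) ℝ) : EuclideanSpace ℝ (UpIndex p) :=
  WithLp.toLp 2 (Sum.elim (fun i ↦ G i i) (fun ij ↦ G ij.1.1 ij.1.2))

/-- The block diagonal covariance matrix with blocks `(1/2) I_p` and `(1/4) I_{p(p-1)/2}`. -/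
def limitCov (p : ℕ) : Matrix (UpIndex p) (UpIndex p) ℝ :=
  Matrix.fromBlocks ((1 / 2 : ℝ) • 1) 0 0 ((1 / 4 : ℝ) • 1)

/-- The 1-Wasserstein distance `sup {|E[h(X)] - E[h(Y)]| : Lip(h) ≤ 1}` between (the laws of) two
integrable random vectors, which may live on different probability spaces. -/
def wassersteinDist {Ω Ω' E : Type*} [MeasurableSpace Ω] [MeasurableSpace Ω']
    [PseudoEMetricSpace E] (P : Measure Ω) (X : Ω → E) (P' : Measure Ω') (Y : Ω' → E) : ℝ≥0∞ :=
  ⨆ (h : E → ℝ) (_ : LipschitzWith 1 h),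
    ENNReal.ofReal |(∫ ω, h (X ω) ∂P) - ∫ ω, h (Y ω) ∂P'|

/-- The explicit rate
`(42 p^(5/2) + 9 p^(9/4) + 18 p^2 + 75 p^(3/2) + 15 p^(5/4) + 56 p) / √m`. -/
def rateBound (p m : ℕ) : ℝ :=
  1 / √(m : ℝ) *
    (42 * (p : ℝ) ^ (5 / 2 : ℝ) + 9 * (p : ℝ) ^ (9 / 4 : ℝ) + 18 * (p : ℝ) ^ 2
      + 75 * (p : ℝ) ^ (3 / 2 : ℝ) + 15 * (p : ℝ) ^ (5 / 4 : ℝ) + 56 * (p : ℝ))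

end

/-! Realize `W` as the Gram matrix of an `m × p` array of independent standard Gaussians, and put `r
= √m`. The identity `W^{1/2} - rI = (W - mI)/(2r) - (W^{1/2} - rI)²/(2r)` splits the problem into a
linear term and a quadratic error.

The error is controlled pathwise: since `W - mI = (W^{1/2} - rI)(W^{1/2} + rI)` and `W^{1/2}` is
positive semidefinite, the Frobenius norm of `W^{1/2} - rI` is at most that of `W - mI` divided by
`r`. The entries of `W - mI` have second moment at most `2m`, so the error has mean norm at most
`p²/√m` (`Matrix.PosSemidef.norm_upVec_sqrt_sub_le`, `integral_centeredGram_sq_le`).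

The linear term `F` has an explicit Stein kernel `τ`, found by integrating by parts in the Gaussian
array (`isSteinKernel_wishartKernel`). With `Σ` the limiting covariance, the entries of `τ - Σ` are
sums of at most two entries of `W - mI`, divided by `4m`, and most of them vanish; hence `E‖τ - Σ‖²
≤ p³/(2m)` in Frobenius norm (`steinDiscrepancy_wishartKernel_le`).

The comparison of `F` with an independent Gaussian `N = Σ^{1/2} z` uses the path `sin θ F + cos θ
N`. Integrating by parts in `F` and in `N` produces second derivatives of the test function `g`; a
further integration by parts in `z`, run backwards, removes them. The derivative of `E g` along the
path becomes `sin θ E⟨∇g, (τ - Σ) Σ^{-1/2} z⟩`, so only `‖∇g‖ ≤ 1` matters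
(`IsSteinKernel.integral_deriv_rotPath`). A weighted Cauchy–Schwarz bound with `tr Σ⁻¹ ≤ 4p²` then
gives `3p^{5/2}/√m`. The total `(p² + 3p^{5/2})/√m` lies strictly below the required rate. -/

/-- Gaussian integration by parts on the real line. -/
theorem integral_id_mul_gaussianReal {f f' : ℝ → ℝ} (hf : ∀ x, HasDerivAt f (f' x) x)
    (h0 : Integrable f (gaussianReal 0 1)) (h1 : Integrable (fun x ↦ x * f x) (gaussianReal 0 1))
    (h2 : Integrable f' (gaussianReal 0 1)) :
    ∫ x, x * f x ∂gaussianReal 0 1 = ∫ x, f' x ∂gaussianReal 0 1 := by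
  have hint : ∀ u : ℝ → ℝ, Integrable u (gaussianReal 0 1) →
      Integrable (fun x ↦ u x * gaussianPDFReal 0 1 x) := by
    intro u hu
    rw [gaussianReal_of_var_ne_zero _ one_ne_zero,
      integrable_withDensity_iff_integrable_smul₀' (by fun_prop)
        (ae_of_all _ fun x ↦ by simp [gaussianPDF])] at hu
    refine hu.congr (ae_of_all _ fun x ↦ ?_)
    simp [gaussianPDF, gaussianPDFReal_nonneg, mul_comm]
  have hpdf : ∀ x, HasDerivAt (gaussianPDFReal 0 1) (-x * gaussianPDFReal 0 1 x) x := by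
    intro x
    have h : HasDerivAt (fun x : ℝ ↦ -(x - 0) ^ 2 / (2 * ((1 : NNReal) : ℝ))) (-x) x := by
      have := (((hasDerivAt_id x).sub_const 0).pow 2).neg.div_const (2 * ((1 : NNReal) : ℝ))
      refine this.congr_deriv ?_
      simp
      ring
    have := (h.exp).const_mul (√(2 * Real.pi * ((1 : NNReal) : ℝ)))⁻¹
    rw [gaussianPDFReal_def]
    refine this.congr_deriv ?_
    ring
  have key := integral_mul_deriv_eq_deriv_mul_of_integrable (u := f) (u' := f')
    (v := gaussianPDFReal 0 1) (v' := fun x ↦ -x * gaussianPDFReal 0 1 x)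
    (fun x _ ↦ hf x) (fun x _ ↦ hpdf x)
    (((hint _ h1).neg).congr (ae_of_all _ fun x ↦ by simp; ring)) (hint _ h2) (hint _ h0)
  rw [integral_gaussianReal_eq_integral_smul one_ne_zero,
    integral_gaussianReal_eq_integral_smul one_ne_zero]
  simp only [smul_eq_mul]
  have e1 : ∫ x, f x * (-x * gaussianPDFReal 0 1 x)
      = -∫ x, gaussianPDFReal 0 1 x * (x * f x) := by
    rw [← integral_neg]; congr 1; ext x; ring
  have e2 : ∫ x, f' x * gaussianPDFReal 0 1 x = ∫ x, gaussianPDFReal 0 1 x * f' x := by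
    congr 1; ext x; ring
  linarith

/-! ### Standard Gaussian product measure: integration by parts and polynomial integrability. -/

section GaussianPi

variable {κ : Type*} [Fintype κ]

/-- The standard Gaussian measure on `κ → ℝ`. -/
noncomputable def gaussianPi (κ : Type*) [Fintype κ] : Measure (κ → ℝ) :=
  Measure.pi fun _ ↦ gaussianReal 0 1

instance : IsProbabilityMeasure (gaussianPi κ) := by
  unfold gaussianPi; infer_instance

/-- Resampling one coordinate of a product of probability measures preserves it. -/
theorem measurePreserving_update [DecidableEq κ] (k : κ) :
    MeasurePreserving (fun q : (κ → ℝ) × ℝ ↦ Function.update q.1 k q.2)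
      ((gaussianPi κ).prod (gaussianReal 0 1)) (gaussianPi κ) := by
  have hm : Measurable fun q : (κ → ℝ) × ℝ ↦ Function.update q.1 k q.2 := by
    refine measurable_pi_lambda _ fun j ↦ ?_
    by_cases h : j = k
    · subst h; simpa using measurable_snd
    · simpa [h, Function.comp_def] using (measurable_pi_apply j).comp measurable_fst
  refine ⟨hm, ?_⟩
  symm
  refine Measure.pi_eq fun s hs ↦ ?_
  rw [Measure.map_apply hm (MeasurableSet.univ_pi hs)]
  -- The old value of coordinate `k` is discarded, so the preimage of a box is a box with its `k`-th
  -- side freed, times that side for the new value.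
  have : (fun q : (κ → ℝ) × ℝ ↦ Function.update q.1 k q.2) ⁻¹' (Set.univ.pi s)
      = (Set.univ.pi (Function.update s k Set.univ)) ×ˢ s k := by
    ext ⟨x, t⟩
    simp only [Set.mem_preimage, Set.mem_pi, Set.mem_univ, true_imp_iff, Set.mem_prod]
    constructor
    · intro h
      refine ⟨fun j ↦ ?_, by simpa using h k⟩
      by_cases hj : j = k
      · subst hj; simp
      · simpa [hj] using h j
    · rintro ⟨h, ht⟩ j
      by_cases hj : j = k
      · subst hj; simpa using ht
      · simpa [hj] using h j
  rw [this, Measure.prod_prod, gaussianPi, Measure.pi_pi,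
    ← Finset.mul_prod_erase _ _ (Finset.mem_univ k),
    ← Finset.mul_prod_erase (a := k) _ (fun i ↦ gaussianReal 0 1 (s i)) (Finset.mem_univ k)]
  simp only [Function.update_self, measure_univ, one_mul]
  rw [mul_comm]
  congr 1
  refine Finset.prod_congr rfl fun j hj ↦ ?_
  simp [(Finset.mem_erase.1 hj).1]

/-- Gaussian integration by parts in one coordinate. -/
theorem integral_eval_mul_gaussianPi [DecidableEq κ] (k : κ) {f f' : (κ → ℝ) → ℝ}
    (hf : ∀ x t, HasDerivAt (fun s ↦ f (Function.update x k s)) (f' (Function.update x k t)) t)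
    (h0 : Integrable f (gaussianPi κ)) (h1 : Integrable (fun x ↦ x k * f x) (gaussianPi κ))
    (h2 : Integrable f' (gaussianPi κ)) :
    ∫ x, x k * f x ∂gaussianPi κ = ∫ x, f' x ∂gaussianPi κ := by
  have mp := measurePreserving_update (κ := κ) k
  have i0 := mp.integrable_comp_of_integrable h0
  have i1 := mp.integrable_comp_of_integrable h1
  have i2 := mp.integrable_comp_of_integrable h2
  -- Resampling coordinate `k` replaces a disintegration of the product: for almost every `x` the
  -- inner integral is a one-dimensional Gaussian integral.
  have tr : ∀ u : (κ → ℝ) → ℝ, Integrable u (gaussianPi κ) →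
      ∫ x, u x ∂gaussianPi κ
        = ∫ x, ∫ t, u (Function.update x k t) ∂gaussianReal 0 1 ∂gaussianPi κ := by
    intro u hu
    have iu := mp.integrable_comp_of_integrable hu
    conv_lhs => rw [← mp.map_eq]
    rw [integral_map mp.measurable.aemeasurable (by rw [mp.map_eq]; exact hu.1)]
    exact integral_prod _ iu
  rw [tr _ h1, tr _ h2]
  refine integral_congr_ae ?_
  filter_upwards [i0.prod_right_ae, i1.prod_right_ae, i2.prod_right_ae] with x a0 a1 a2
  simp only [Function.comp_def, Function.update_self] at a0 a1 a2 ⊢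
  exact integral_id_mul_gaussianReal (hf x) a0 a1 a2

/-- At most polynomial growth. -/
def HasPolyGrowth (f : (κ → ℝ) → ℝ) : Prop :=
  ∃ (C : ℝ) (n : ℕ), 0 ≤ C ∧ ∀ x, |f x| ≤ C * (1 + ‖x‖) ^ n

theorem HasPolyGrowth.of_bound {f : (κ → ℝ) → ℝ} {C : ℝ} (h : ∀ x, |f x| ≤ C) :
    HasPolyGrowth f :=
  ⟨C, 0, (abs_nonneg _).trans (h 0), by simpa using h⟩

theorem HasPolyGrowth.const (c : ℝ) : HasPolyGrowth fun _ : κ → ℝ ↦ c :=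
  .of_bound fun _ ↦ le_rfl

theorem HasPolyGrowth.eval (k : κ) : HasPolyGrowth fun x : κ → ℝ ↦ x k :=
  ⟨1, 1, zero_le_one, fun x ↦ by
    have := norm_le_pi_norm x k
    rw [Real.norm_eq_abs] at this
    linarith⟩

theorem HasPolyGrowth.mul {f g : (κ → ℝ) → ℝ} (hf : HasPolyGrowth f) (hg : HasPolyGrowth g) :
    HasPolyGrowth fun x ↦ f x * g x := by
  obtain ⟨C, n, hC, h⟩ := hf
  obtain ⟨D, k, hD, h'⟩ := hg
  refine ⟨C * D, n + k, mul_nonneg hC hD, fun x ↦ ?_⟩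
  rw [abs_mul, pow_add]
  calc |f x| * |g x| ≤ (C * (1 + ‖x‖) ^ n) * (D * (1 + ‖x‖) ^ k) :=
        mul_le_mul (h x) (h' x) (abs_nonneg _) (by positivity)
    _ = _ := by ring

theorem HasPolyGrowth.add {f g : (κ → ℝ) → ℝ} (hf : HasPolyGrowth f) (hg : HasPolyGrowth g) :
    HasPolyGrowth fun x ↦ f x + g x := by
  obtain ⟨C, n, hC, h⟩ := hf
  obtain ⟨D, k, hD, h'⟩ := hg
  refine ⟨C + D, n + k, add_nonneg hC hD, fun x ↦ ?_⟩
  have h1 : (1 : ℝ) ≤ 1 + ‖x‖ := by linarith [norm_nonneg x]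
  have a1 : (1 + ‖x‖) ^ n ≤ (1 + ‖x‖) ^ (n + k) := pow_le_pow_right₀ h1 (by omega)
  have a2 : (1 + ‖x‖) ^ k ≤ (1 + ‖x‖) ^ (n + k) := pow_le_pow_right₀ h1 (by omega)
  calc |f x + g x| ≤ |f x| + |g x| := abs_add_le _ _
    _ ≤ C * (1 + ‖x‖) ^ n + D * (1 + ‖x‖) ^ k := add_le_add (h x) (h' x)
    _ ≤ C * (1 + ‖x‖) ^ (n + k) + D * (1 + ‖x‖) ^ (n + k) := by gcongr
    _ = _ := by ring

theorem HasPolyGrowth.sub {f g : (κ → ℝ) → ℝ} (hf : HasPolyGrowth f) (hg : HasPolyGrowth g) :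
    HasPolyGrowth fun x ↦ f x - g x := by
  simpa [sub_eq_add_neg] using hf.add ((HasPolyGrowth.const (-1)).mul hg)

theorem HasPolyGrowth.sum {α : Type*} (s : Finset α) {f : α → (κ → ℝ) → ℝ}
    (hf : ∀ a ∈ s, HasPolyGrowth (f a)) : HasPolyGrowth fun x ↦ ∑ a ∈ s, f a x := by
  classical
  induction s using Finset.induction_on with
  | empty => simpa using HasPolyGrowth.const 0
  | insert a s ha ih =>
    simp only [Finset.sum_insert ha]
    exact (hf a (by simp)).add (ih fun b hb ↦ hf b (by simp [hb]))

theorem HasPolyGrowth.pow {f : (κ → ℝ) → ℝ} (hf : HasPolyGrowth f) (n : ℕ) :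
    HasPolyGrowth fun x ↦ f x ^ n := by
  induction n with
  | zero => simpa using HasPolyGrowth.const 1
  | succ n ih => simpa only [pow_succ] using ih.mul hf

/-- The sup norm is attained at some coordinate, so `(1 + ‖x‖)^n ≤ 2^n (1 + ∑ |x k|^n)`, and
one-dimensional Gaussians have all moments. -/
theorem HasPolyGrowth.integrable {f : (κ → ℝ) → ℝ} (hf : HasPolyGrowth f)
    (hm : AEStronglyMeasurable f (gaussianPi κ)) : Integrable f (gaussianPi κ) := by
  obtain ⟨C, n, hC, h⟩ := hf
  have hk : ∀ k : κ, Integrable (fun x : κ → ℝ ↦ |x k| ^ n) (gaussianPi κ) := fun k ↦ by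
    have : MemLp id n (gaussianReal 0 1) := memLp_id_gaussianReal' _ (by simp)
    have h2 := this.integrable_norm_pow' 
    simp only [id, Real.norm_eq_abs] at h2
    exact integrable_comp_eval (μ := fun _ : κ ↦ gaussianReal 0 1) (i := k) h2
  have hs : Integrable (fun x : κ → ℝ ↦ C * (2 ^ n * (1 + ∑ k, |x k| ^ n))) (gaussianPi κ) :=
    (((integrable_const 1).add (integrable_finsetSum _ fun k _ ↦ hk k)).const_mul _).const_mul _
  refine hs.mono' hm (ae_of_all _ fun x ↦ ?_)
  rw [Real.norm_eq_abs]
  refine (h x).trans (mul_le_mul_of_nonneg_left ?_ hC)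
  have hmax : (1 + ‖x‖) ^ n ≤ 2 ^ n * max 1 (‖x‖ ^ n) := by
    have : (1 : ℝ) + ‖x‖ ≤ 2 * max 1 ‖x‖ := by
      linarith [le_max_left 1 ‖x‖, le_max_right 1 ‖x‖]
    calc (1 + ‖x‖) ^ n ≤ (2 * max 1 ‖x‖) ^ n := by gcongr
      _ = 2 ^ n * max 1 (‖x‖ ^ n) := by
        rw [mul_pow]
        congr 1
        rcases le_total 1 ‖x‖ with h1 | h1
        · rw [max_eq_right h1, max_eq_right (one_le_pow₀ h1)]
        · rw [max_eq_left h1, max_eq_left (pow_le_one₀ (norm_nonneg _) h1), one_pow]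
  refine hmax.trans (mul_le_mul_of_nonneg_left (max_le ?_ ?_) (by positivity))
  · exact le_add_of_nonneg_right (Finset.sum_nonneg fun _ _ ↦ by positivity)
  · rcases isEmpty_or_nonempty κ with he | he
    · rw [Subsingleton.elim x 0, norm_zero]
      rcases Nat.eq_zero_or_pos n with rfl | hn
      · simp
      · simp [hn.ne']
    · obtain ⟨k, -, hk⟩ := Finset.exists_max_image Finset.univ (fun k ↦ |x k|) Finset.univ_nonempty
      have hx : ‖x‖ ≤ |x k| := (pi_norm_le_iff_of_nonneg (abs_nonneg _)).2 fun j ↦ hk j (by simp)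
      calc ‖x‖ ^ n ≤ |x k| ^ n := by gcongr
        _ ≤ ∑ k, |x k| ^ n :=
          Finset.single_le_sum (f := fun k ↦ |x k| ^ n) (fun _ _ ↦ by positivity)
            (Finset.mem_univ k)
        _ ≤ _ := by linarith

theorem integrable_eval_gaussianPi (k : κ) : Integrable (fun x : κ → ℝ ↦ x k) (gaussianPi κ) :=
  (HasPolyGrowth.eval k).integrable (measurable_pi_apply k).aestronglyMeasurable

theorem integrable_eval_sq_gaussianPi (k : κ) :
    Integrable (fun x : κ → ℝ ↦ x k ^ 2) (gaussianPi κ) :=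
  ((HasPolyGrowth.eval k).pow 2).integrable
    ((measurable_pi_apply k).pow_const 2).aestronglyMeasurable

theorem integral_eval_sq_gaussianPi (k : κ) :
    ∫ x : κ → ℝ, x k ^ 2 ∂gaussianPi κ = 1 := by
  classical
  have := integral_eval_mul_gaussianPi (κ := κ) k (f := fun x ↦ x k) (f' := fun _ ↦ 1)
    (fun x t ↦ by simpa using hasDerivAt_id' t) (integrable_eval_gaussianPi k)
    (by simpa [pow_two] using integrable_eval_sq_gaussianPi k) (integrable_const 1)
  simpa [pow_two] using this

end GaussianPi

/-! ### Mollification of Lipschitz functions. -/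

open scoped Convolution in
/-- A Lipschitz function is a uniform limit of `C²` functions with the same Lipschitz constant
and Lipschitz derivative. -/
theorem LipschitzWith.exists_contDiff_approx {E : Type*} [NormedAddCommGroup E]
    [InnerProductSpace ℝ E] [FiniteDimensional ℝ E] [MeasurableSpace E] [BorelSpace E]
    {h : E → ℝ} (hh : LipschitzWith 1 h) {ε : ℝ} (hε : 0 < ε) :
    ∃ g : E → ℝ, ContDiff ℝ 2 g ∧ LipschitzWith 1 g ∧ (∃ M, LipschitzWith M (fderiv ℝ g)) ∧
      ∀ x, |g x - h x| ≤ ε := by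
  set φ : ContDiffBump (0 : E) := ⟨ε / 2, ε, half_pos hε, half_lt_self hε⟩
  set μ : Measure E := volume
  set ψ := φ.normed μ
  have hψc : HasCompactSupport ψ := φ.hasCompactSupport_normed
  have hψ1 : ContDiff ℝ 2 ψ := φ.contDiff_normed
  have hloc : LocallyIntegrable h μ := hh.continuous.locallyIntegrable
  have hmeas : AEStronglyMeasurable h μ := hh.continuous.aestronglyMeasurable
  set L := ContinuousLinearMap.lsmul ℝ ℝ (E := ℝ)
  set g : E → ℝ := ψ ⋆[L, μ] h
  have hψi : Integrable ψ μ := φ.integrable_normed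
  have hex : ∀ x, Integrable (fun t ↦ ψ t * h (x - t)) μ := fun x ↦
    hψc.convolutionExists_left L hψ1.continuous hloc x
  -- Averaging this bound against the probability density `ψ` preserves the Lipschitz constant;
  -- integrating it against `‖∇ψ‖` makes the derivative Lipschitz.
  have hdist : ∀ x y t, |h (x - t) - h (y - t)| ≤ ‖x - y‖ := fun x y t ↦ by
    have := hh.dist_le_mul (x - t) (y - t)
    rwa [Real.dist_eq, dist_sub_right, dist_eq_norm, NNReal.coe_one, one_mul] at this
  refine ⟨g, hψc.contDiff_convolution_left L (n := 2) hψ1 hloc, ?_, ?_, ?_⟩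
  · refine LipschitzWith.of_dist_le_mul fun x y ↦ ?_
    rw [Real.dist_eq, NNReal.coe_one, one_mul, dist_eq_norm]
    have : g x - g y = ∫ t, ψ t * (h (x - t) - h (y - t)) ∂μ := by
      change (∫ t, ψ t * h (x - t) ∂μ) - (∫ t, ψ t * h (y - t) ∂μ) = _
      rw [← integral_sub (hex x) (hex y)]
      simp only [mul_sub]
    rw [this, ← Real.norm_eq_abs]
    calc _ ≤ ∫ t, ψ t * ‖x - y‖ ∂μ := by
          refine norm_integral_le_of_norm_le (hψi.mul_const _) (ae_of_all _ fun t ↦ ?_)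
          rw [norm_mul, Real.norm_eq_abs, abs_of_nonneg (φ.nonneg_normed t)]
          exact mul_le_mul_of_nonneg_left (hdist x y t) (φ.nonneg_normed t)
      _ = ‖x - y‖ := by
          rw [integral_mul_const, φ.integral_normed, one_mul]
  · have hd := fun x ↦ (hψc.hasFDerivAt_convolution_left L (hψ1.of_le (by norm_num)) hloc x).fderiv
    set L' := L.precompL E
    have hL' : ∀ (u : E →L[ℝ] ℝ) (c : ℝ), ‖L' u c‖ ≤ ‖u‖ * |c| := fun u c ↦ by
      refine ContinuousLinearMap.opNorm_le_bound _ (by positivity) fun v ↦ ?_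
      have : (L' u c) v = u v * c := rfl
      rw [this, norm_mul, Real.norm_eq_abs c]
      calc ‖u v‖ * |c| ≤ (‖u‖ * ‖v‖) * |c| := by gcongr; exact u.le_opNorm v
        _ = _ := by ring
    have hDc : HasCompactSupport (fderiv ℝ ψ) := hψc.fderiv ℝ
    have hDcont : Continuous (fderiv ℝ ψ) := hψ1.continuous_fderiv (by norm_num)
    have hex' : ∀ x, Integrable (fun t ↦ L' (fderiv ℝ ψ t) (h (x - t))) μ := fun x ↦
      hDc.convolutionExists_left L' hDcont hloc x
    have hDi : Integrable (fun t ↦ ‖fderiv ℝ ψ t‖) μ :=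
      (hDcont.integrable_of_hasCompactSupport hDc).norm
    have hnn : 0 ≤ ∫ t, ‖fderiv ℝ ψ t‖ ∂μ := integral_nonneg fun t ↦ by positivity
    refine ⟨NNReal.mk _ hnn, LipschitzWith.of_dist_le_mul fun x y ↦ ?_⟩
    rw [dist_eq_norm, dist_eq_norm, NNReal.coe_mk]
    have : fderiv ℝ g x - fderiv ℝ g y
        = ∫ t, L' (fderiv ℝ ψ t) (h (x - t) - h (y - t)) ∂μ := by
      rw [hd, hd]
      change (∫ t, L' (fderiv ℝ ψ t) (h (x - t)) ∂μ) - (∫ t, L' (fderiv ℝ ψ t) (h (y - t)) ∂μ) = _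
      rw [← integral_sub (hex' x) (hex' y)]
      simp only [map_sub]
    rw [this, ← integral_mul_const]
    refine norm_integral_le_of_norm_le (hDi.mul_const _) (ae_of_all _ fun t ↦ ?_)
    refine (hL' _ _).trans (mul_le_mul_of_nonneg_left (hdist x y t) (norm_nonneg _))
  · intro x
    rw [← Real.dist_eq]
    refine φ.dist_normed_convolution_le hmeas fun y hy ↦ ?_
    have := hh.dist_le_mul y x
    rw [NNReal.coe_one, one_mul] at this
    exact this.trans (Metric.mem_ball.1 hy).le

/-! ### Stein kernels and the derivative along the rotation path. -/

section SteinKernel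

variable {Ω : Type*} [MeasurableSpace Ω]

theorem integrable_continuous_mul {ν : Measure Ω} {E : Type*} [TopologicalSpace E] {u : E → ℝ}
    {C : ℝ} {v : Ω → ℝ} {Y : Ω → E} (hu : Continuous u) (hb : ∀ y, |u y| ≤ C)
    (hv : Integrable v ν) (hY : AEStronglyMeasurable Y ν) :
    Integrable (fun ω ↦ v ω * u (Y ω)) ν :=
  hv.mul_bdd (hu.comp_aestronglyMeasurable hY) (ae_of_all _ fun _ ↦ hb _)

/-- The vector with coordinates `σ b * z b`. -/
noncomputable def scaleVec {ι : Type*} (σ : ι → ℝ) (z : ι → ℝ) : EuclideanSpace ℝ ι :=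
  WithLp.toLp 2 fun b ↦ σ b * z b

theorem continuous_scaleVec {ι : Type*} (σ : ι → ℝ) : Continuous (scaleVec σ) := by
  unfold scaleVec; fun_prop

theorem scaleVec_update {ι : Type*} [DecidableEq ι] (σ z : ι → ℝ) (b : ι) (s : ℝ) :
    scaleVec σ (Function.update z b s)
      = scaleVec σ (Function.update z b 0) + s • (σ b • EuclideanSpace.single b 1) := by
  ext a
  by_cases h : a = b
  · subst h; simp [scaleVec, mul_comm]
  · simp [scaleVec, h]

theorem fderiv_comp_affine {ι : Type*} [Fintype ι] {G : EuclideanSpace ℝ ι → ℝ} (hG : ContDiff ℝ 1 G) (s : ℝ)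
    (c y : EuclideanSpace ℝ ι) :
    HasFDerivAt (fun y ↦ G (s • y + c)) (s • fderiv ℝ G (s • y + c)) y := by
  have h1 : HasFDerivAt (fun y : EuclideanSpace ℝ ι ↦ s • y + c)
      (s • ContinuousLinearMap.id ℝ (EuclideanSpace ℝ ι)) y :=
    ((hasFDerivAt_id y).const_smul s).add_const c
  have := ((hG.differentiable one_ne_zero).differentiableAt.hasFDerivAt
    (x := s • y + c)).comp y h1
  refine this.congr_fderiv ?_
  ext v; simp

/-- The rotation path between `F` and a Gaussian vector. -/
noncomputable def rotPath {ι : Type*} (F : Ω → EuclideanSpace ℝ ι) (σ : ι → ℝ) (θ : ℝ) (q : Ω × (ι → ℝ)) :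
    EuclideanSpace ℝ ι :=
  Real.sin θ • F q.1 + Real.cos θ • scaleVec σ q.2

theorem aestronglyMeasurable_rotPath {ι : Type*} [Fintype ι] {μ : Measure Ω} [SFinite μ] {F : Ω → EuclideanSpace ℝ ι} (hF : Integrable F μ) (σ : ι → ℝ)
    (θ : ℝ) : AEStronglyMeasurable (rotPath F σ θ) (μ.prod (gaussianPi ι)) := by
  have h1 : AEStronglyMeasurable (fun q : Ω × (ι → ℝ) ↦ F q.1) (μ.prod (gaussianPi ι)) :=
    (hF.comp_fst _).aestronglyMeasurable
  have h2 : AEStronglyMeasurable (fun q : Ω × (ι → ℝ) ↦ scaleVec σ q.2)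
      (μ.prod (gaussianPi ι)) :=
    (continuous_scaleVec σ).comp_aestronglyMeasurable measurable_snd.aestronglyMeasurable
  exact (h1.const_smul (Real.sin θ)).add (h2.const_smul (Real.cos θ))

variable {ι : Type*} [Fintype ι] [DecidableEq ι]

theorem clm_apply_eq_sum (u : EuclideanSpace ℝ ι →L[ℝ] ℝ) (v : EuclideanSpace ℝ ι) :
    u v = ∑ b, v b * u (EuclideanSpace.single b 1) := by
  have hv : v = ∑ b, v b • EuclideanSpace.single b (1 : ℝ) := by
    ext a; simp [Pi.single_apply]
  conv_lhs => rw [hv]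
  simp

/-- A Stein kernel of a random vector `F`: the rows `τ a` satisfy
`E[F_a G(F)] = E[⟨∇G(F), τ a⟩]` for every bounded `C¹` function `G` with bounded derivative. -/
structure IsSteinKernel (μ : Measure Ω) (F : Ω → EuclideanSpace ℝ ι)
    (τ : ι → Ω → EuclideanSpace ℝ ι) : Prop where
  integrable : Integrable F μ
  integrable_kernel : ∀ a b, Integrable (fun ω ↦ τ a ω b) μ
  integral_eq : ∀ a (G : EuclideanSpace ℝ ι → ℝ), ContDiff ℝ 1 G → (∃ C, ∀ y, |G y| ≤ C) →
    (∃ C, ∀ y, ‖fderiv ℝ G y‖ ≤ C) →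
      ∫ ω, F ω a * G (F ω) ∂μ = ∫ ω, fderiv ℝ G (F ω) (τ a ω) ∂μ

theorem abs_fderiv_single_le {G : EuclideanSpace ℝ ι → ℝ} {C : ℝ} (h : ∀ y, ‖fderiv ℝ G y‖ ≤ C)
    (b : ι) (y : EuclideanSpace ℝ ι) : |fderiv ℝ G y (EuclideanSpace.single b 1)| ≤ C := by
  refine ((fderiv ℝ G y).le_opNorm _).trans ?_
  simpa using h y

/-- The Stein identity for the test function `y ↦ G (s • y + c)`; in the application `c` is the
Gaussian part of the path, held fixed. -/
theorem IsSteinKernel.integral_affine {μ : Measure Ω} {F : Ω → EuclideanSpace ℝ ι}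
    {τ : ι → Ω → EuclideanSpace ℝ ι} (hτ : IsSteinKernel μ F τ) {G : EuclideanSpace ℝ ι → ℝ}
    (hG : ContDiff ℝ 1 G) {C D : ℝ} (hC : ∀ y, |G y| ≤ C) (hD : ∀ y, ‖fderiv ℝ G y‖ ≤ D)
    (a : ι) (s : ℝ) (c : EuclideanSpace ℝ ι) :
    ∫ ω, F ω a * G (s • F ω + c) ∂μ
      = ∑ b, ∫ ω, s * (τ a ω b * fderiv ℝ G (s • F ω + c) (EuclideanSpace.single b 1)) ∂μ := by
  have hfd : ∀ y, fderiv ℝ (fun y ↦ G (s • y + c)) y = s • fderiv ℝ G (s • y + c) := fun y ↦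
    (fderiv_comp_affine hG s c y).fderiv
  have h := hτ.integral_eq a (fun y ↦ G (s • y + c))
    (hG.comp ((contDiff_id.const_smul s).add contDiff_const)) ⟨C, fun y ↦ hC _⟩
    ⟨|s| * D, fun y ↦ by
      rw [hfd, norm_smul, Real.norm_eq_abs]
      exact mul_le_mul_of_nonneg_left (hD _) (abs_nonneg _)⟩
  rw [h, ← integral_finsetSum]
  · refine integral_congr_ae (ae_of_all _ fun ω ↦ ?_)
    simp only [hfd]
    rw [clm_apply_eq_sum]
    refine Finset.sum_congr rfl fun b _ ↦ ?_
    simp only [smul_apply, smul_eq_mul]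
    ring
  · intro b _
    refine (integrable_continuous_mul
      (u := fun y ↦ fderiv ℝ G (s • y + c) (EuclideanSpace.single b 1)) ?_
      (fun y ↦ abs_fderiv_single_le hD b _) (hτ.integrable_kernel a b)
      hτ.integrable.aestronglyMeasurable).const_mul s
    have := hG.continuous_fderiv one_ne_zero
    fun_prop

theorem integral_eval_mul_comp_scaleVec {G : EuclideanSpace ℝ ι → ℝ}
    (hG : ContDiff ℝ 1 G) {C D : ℝ} (hC : ∀ y, |G y| ≤ C) (hD : ∀ y, ‖fderiv ℝ G y‖ ≤ D)
    (σ : ι → ℝ) (b : ι) (r : ℝ) (c : EuclideanSpace ℝ ι) :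
    ∫ z, z b * G (c + r • scaleVec σ z) ∂gaussianPi ι
      = ∫ z, r * σ b * fderiv ℝ G (c + r • scaleVec σ z) (EuclideanSpace.single b 1)
          ∂gaussianPi ι := by
  have hcs := continuous_scaleVec σ
  have hGc := hG.continuous
  have hGd := hG.continuous_fderiv one_ne_zero
  refine integral_eval_mul_gaussianPi b (fun z t ↦ ?_) ?_ ?_ ?_
  · have h1 : HasDerivAt (fun s ↦ c + r • scaleVec σ (Function.update z b s))
        (r • ((1 : ℝ) • (σ b • EuclideanSpace.single b 1))) t := by
      have e : (fun s ↦ c + r • scaleVec σ (Function.update z b s)) = fun s ↦ c + r •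
          (scaleVec σ (Function.update z b 0) + s • (σ b • EuclideanSpace.single b (1 : ℝ))) :=
        funext fun s ↦ by rw [scaleVec_update σ z b s]
      rw [e]
      exact ((((hasDerivAt_id' t).smul_const _).const_add _).const_smul r).const_add c
    have := (hG.differentiable one_ne_zero).differentiableAt.hasFDerivAt.comp_hasDerivAt t h1
    refine this.congr_deriv ?_
    simp [mul_assoc]
  · exact (HasPolyGrowth.of_bound (C := C) fun z ↦ hC _).integrable
      (by fun_prop : Continuous _).aestronglyMeasurable
  · exact ((HasPolyGrowth.eval b).mul (HasPolyGrowth.of_bound (C := C) fun z ↦ hC _)).integrable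
      (by fun_prop : Continuous _).aestronglyMeasurable
  · exact ((HasPolyGrowth.const _).mul (HasPolyGrowth.of_bound (C := D) fun z ↦
      abs_fderiv_single_le hD b _)).integrable (by fun_prop : Continuous _).aestronglyMeasurable

variable {μ : Measure Ω} [IsProbabilityMeasure μ]

/-- Integration by parts in the Gaussian component along the rotation path. -/
theorem integral_weight_mul_eval_mul_rotPath {F : Ω → EuclideanSpace ℝ ι} (hF : Integrable F μ)
    {G : EuclideanSpace ℝ ι → ℝ}
    (hG : ContDiff ℝ 1 G) {C D : ℝ} (hC : ∀ y, |G y| ≤ C) (hD : ∀ y, ‖fderiv ℝ G y‖ ≤ D)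
    (σ : ι → ℝ) (b : ι) (θ : ℝ) {d : Ω → ℝ} (hd : Integrable d μ) :
    ∫ q, d q.1 * q.2 b * G (rotPath F σ θ q) ∂μ.prod (gaussianPi ι)
      = Real.cos θ * σ b * ∫ q, d q.1 *
          fderiv ℝ G (rotPath F σ θ q) (EuclideanSpace.single b 1) ∂μ.prod (gaussianPi ι) := by
  have hY := aestronglyMeasurable_rotPath hF σ θ
  have hGd := hG.continuous_fderiv one_ne_zero
  have i1 := integrable_continuous_mul hG.continuous hC
    (hd.mul_prod (integrable_eval_gaussianPi b)) hY
  have i2 := integrable_continuous_mul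
    (u := fun y ↦ fderiv ℝ G y (EuclideanSpace.single b 1)) (by fun_prop)
    (abs_fderiv_single_le hD b) (hd.comp_fst (gaussianPi ι)) hY
  rw [integral_prod _ i1, integral_prod _ i2, ← integral_const_mul]
  refine integral_congr_ae (ae_of_all _ fun ω ↦ ?_)
  simp only [rotPath, mul_assoc]
  rw [integral_const_mul, integral_const_mul,
    integral_eval_mul_comp_scaleVec hG hC hD σ b (Real.cos θ) (Real.sin θ • F ω),
    integral_const_mul]
  ring

/-- Fubini with the Gaussian variable outside: for each fixed `z` the path is affine in `F`. -/
theorem IsSteinKernel.integral_rotPath {F : Ω → EuclideanSpace ℝ ι}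
    {τ : ι → Ω → EuclideanSpace ℝ ι} (hτ : IsSteinKernel μ F τ) {G : EuclideanSpace ℝ ι → ℝ}
    (hG : ContDiff ℝ 1 G) {C D : ℝ} (hC : ∀ y, |G y| ≤ C) (hD : ∀ y, ‖fderiv ℝ G y‖ ≤ D)
    (σ : ι → ℝ) (a : ι) (θ : ℝ) :
    ∫ q, F q.1 a * G (rotPath F σ θ q) ∂μ.prod (gaussianPi ι)
      = Real.sin θ * ∑ b, ∫ q, τ a q.1 b *
          fderiv ℝ G (rotPath F σ θ q) (EuclideanSpace.single b 1) ∂μ.prod (gaussianPi ι) := by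
  have hY := aestronglyMeasurable_rotPath hτ.integrable σ θ
  have hGd := hG.continuous_fderiv one_ne_zero
  have hFa : Integrable (fun ω ↦ F ω a) μ :=
    (EuclideanSpace.proj (𝕜 := ℝ) a).integrable_comp hτ.integrable
  have i1 := integrable_continuous_mul hG.continuous hC (hFa.comp_fst (gaussianPi ι)) hY
  have i2 := fun b ↦ integrable_continuous_mul
    (u := fun y ↦ fderiv ℝ G y (EuclideanSpace.single b 1)) (by fun_prop)
    (abs_fderiv_single_le hD b) ((hτ.integrable_kernel a b).comp_fst (gaussianPi ι)) hY
  rw [integral_prod_symm _ i1, Finset.mul_sum]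
  have e : ∀ z, ∫ ω, F ω a * G (rotPath F σ θ (ω, z)) ∂μ
      = ∑ b, Real.sin θ * ∫ ω, τ a ω b *
        fderiv ℝ G (rotPath F σ θ (ω, z)) (EuclideanSpace.single b 1) ∂μ := fun z ↦ by
    simp only [rotPath, ← integral_const_mul]
    exact hτ.integral_affine hG hC hD a _ _
  simp only [e]
  rw [integral_finsetSum _ fun b _ ↦ (i2 b).integral_prod_right.const_mul _]
  refine Finset.sum_congr rfl fun b _ ↦ ?_
  rw [integral_const_mul, integral_prod_symm _ (i2 b)]

/-- The derivative of the smart path, in a form which involves only first derivatives. -/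
theorem IsSteinKernel.integral_deriv_rotPath {F : Ω → EuclideanSpace ℝ ι}
    {τ : ι → Ω → EuclideanSpace ℝ ι} (hτ : IsSteinKernel μ F τ) {g : EuclideanSpace ℝ ι → ℝ}
    (hg : ContDiff ℝ 2 g) {C D : ℝ} (hC : ∀ y, ‖fderiv ℝ g y‖ ≤ C)
    (hD : ∀ y, ‖fderiv ℝ (fderiv ℝ g) y‖ ≤ D) {σ : ι → ℝ} (hσ : ∀ b, σ b ≠ 0) (θ : ℝ) :
    ∫ q, fderiv ℝ g (rotPath F σ θ q) (Real.cos θ • F q.1 - Real.sin θ • scaleVec σ q.2)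
        ∂μ.prod (gaussianPi ι)
      = Real.sin θ * ∫ q, fderiv ℝ g (rotPath F σ θ q) (WithLp.toLp 2 fun a ↦
          ∑ b, (τ a q.1 b - if a = b then σ a ^ 2 else 0) * (q.2 b / σ b))
        ∂μ.prod (gaussianPi ι) := by
  set ν := μ.prod (gaussianPi ι)
  have hY := aestronglyMeasurable_rotPath hτ.integrable σ θ
  set G : ι → EuclideanSpace ℝ ι → ℝ := fun a y ↦ fderiv ℝ g y (EuclideanSpace.single a 1)
  have hg1 : ContDiff ℝ 1 (fderiv ℝ g) := hg.fderiv_right (by norm_num)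
  have hG : ∀ a, ContDiff ℝ 1 (G a) := fun a ↦ hg1.clm_apply contDiff_const
  have hGC : ∀ a y, |G a y| ≤ C := fun a y ↦ abs_fderiv_single_le hC a y
  have hGf : ∀ a y, fderiv ℝ (G a) y
      = (ContinuousLinearMap.apply ℝ ℝ (EuclideanSpace.single a 1)).comp
        (fderiv ℝ (fderiv ℝ g) y) := fun a y ↦
    ((ContinuousLinearMap.apply ℝ ℝ (EuclideanSpace.single a (1 : ℝ))).hasFDerivAt.comp y
      (hg1.differentiable one_ne_zero).differentiableAt.hasFDerivAt).fderiv
  have hGD : ∀ a y, ‖fderiv ℝ (G a) y‖ ≤ D := fun a y ↦ by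
    have hD0 : 0 ≤ D := le_trans (norm_nonneg (fderiv ℝ (fderiv ℝ g) y)) (hD y)
    rw [hGf]
    refine ContinuousLinearMap.opNorm_le_bound _ hD0 fun v ↦ ?_
    simp only [ContinuousLinearMap.comp_apply, ContinuousLinearMap.apply_apply]
    refine (ContinuousLinearMap.le_opNorm _ _).trans ?_
    simp only [PiLp.norm_single, norm_one, mul_one]
    exact ((fderiv ℝ (fderiv ℝ g) y).le_opNorm v).trans
      (mul_le_mul_of_nonneg_right (hD y) (norm_nonneg _))
  have hGDc : ∀ a, Continuous (fderiv ℝ (G a)) := fun a ↦ (hG a).continuous_fderiv one_ne_zero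
  have hFa : ∀ a, Integrable (fun ω ↦ F ω a) μ := fun a ↦
    (EuclideanSpace.proj (𝕜 := ℝ) a).integrable_comp hτ.integrable
  have jF : ∀ a, Integrable (fun q : Ω × (ι → ℝ) ↦ F q.1 a * G a (rotPath F σ θ q)) ν := fun a ↦
    integrable_continuous_mul (hG a).continuous (hGC a) ((hFa a).comp_fst (gaussianPi ι)) hY
  have jd : ∀ (d : Ω → ℝ) (_ : Integrable d μ) a b,
      Integrable (fun q : Ω × (ι → ℝ) ↦ d q.1 * q.2 b * G a (rotPath F σ θ q)) ν :=
    fun d hd a b ↦ integrable_continuous_mul (hG a).continuous (hGC a)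
      (hd.mul_prod (integrable_eval_gaussianPi b)) hY
  have jH : ∀ (d : Ω → ℝ) (_ : Integrable d μ) a b, Integrable (fun q : Ω × (ι → ℝ) ↦ d q.1 *
      fderiv ℝ (G a) (rotPath F σ θ q) (EuclideanSpace.single b 1)) ν := fun d hd a b ↦
    integrable_continuous_mul
      (u := fun y ↦ fderiv ℝ (G a) y (EuclideanSpace.single b 1))
      (by have := hGDc a; fun_prop) (abs_fderiv_single_le (hGD a) b)
      (hd.comp_fst (gaussianPi ι)) hY
  have jc : ∀ a b, Integrable (fun ω ↦ τ a ω b - if a = b then σ a ^ 2 else 0) μ := fun a b ↦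
    (hτ.integrable_kernel a b).sub (integrable_const _)
  set H : ι → ι → ℝ := fun a b ↦
    ∫ q, fderiv ℝ (G a) (rotPath F σ θ q) (EuclideanSpace.single b 1) ∂ν 
  have I2 : ∀ a, ∫ q, q.2 a * G a (rotPath F σ θ q) ∂ν = Real.cos θ * σ a * H a a := fun a ↦ by
    simpa using integral_weight_mul_eval_mul_rotPath hτ.integrable (hG a) (hGC a) (hGD a) σ a θ
      (integrable_const (1 : ℝ))
  have jz : ∀ a, Integrable (fun q : Ω × (ι → ℝ) ↦ q.2 a * G a (rotPath F σ θ q)) ν := fun a ↦ by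
    simpa using jd (fun _ ↦ 1) (integrable_const _) a a
  have lhs : ∫ q, fderiv ℝ g (rotPath F σ θ q)
        (Real.cos θ • F q.1 - Real.sin θ • scaleVec σ q.2) ∂ν
      = ∑ a, (Real.cos θ * ∫ q, F q.1 a * G a (rotPath F σ θ q) ∂ν
          - Real.sin θ * σ a * ∫ q, q.2 a * G a (rotPath F σ θ q) ∂ν) := by
    simp only [← integral_const_mul]
    have e : ∀ a, (∫ q, Real.cos θ * (F q.1 a * G a (rotPath F σ θ q)) ∂ν)
        - ∫ q, Real.sin θ * σ a * (q.2 a * G a (rotPath F σ θ q)) ∂ν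
        = ∫ q, (Real.cos θ * (F q.1 a * G a (rotPath F σ θ q))
          - Real.sin θ * σ a * (q.2 a * G a (rotPath F σ θ q))) ∂ν := fun a ↦
      (integral_sub ((jF a).const_mul _) ((jz a).const_mul _)).symm
    have i : ∀ a ∈ Finset.univ, Integrable (fun q : Ω × (ι → ℝ) ↦
        Real.cos θ * (F q.1 a * G a (rotPath F σ θ q))
          - Real.sin θ * σ a * (q.2 a * G a (rotPath F σ θ q))) ν := fun a _ ↦
      ((jF a).const_mul _).sub ((jz a).const_mul _)
    simp only [e]
    rw [← integral_finsetSum _ i]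
    refine integral_congr_ae (ae_of_all _ fun q ↦ ?_)
    simp only
    rw [clm_apply_eq_sum]
    refine Finset.sum_congr rfl fun a _ ↦ ?_
    simp only [PiLp.sub_apply, PiLp.smul_apply, smul_eq_mul, scaleVec, G]
    ring
  have rhs : ∫ q, fderiv ℝ g (rotPath F σ θ q) (WithLp.toLp 2 fun a ↦
          ∑ b, (τ a q.1 b - if a = b then σ a ^ 2 else 0) * (q.2 b / σ b)) ∂ν
      = ∑ a, ∑ b, (σ b)⁻¹ * ∫ q, (τ a q.1 b - if a = b then σ a ^ 2 else 0) * q.2 b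
          * G a (rotPath F σ θ q) ∂ν := by
    simp only [← integral_const_mul]
    simp_rw [← integral_finsetSum Finset.univ
      fun b _ ↦ (jd _ (jc _ b) _ b).const_mul (σ b)⁻¹]
    rw [← integral_finsetSum _ fun a _ ↦ integrable_finsetSum _
      fun b _ ↦ (jd _ (jc a b) a b).const_mul (σ b)⁻¹]
    refine integral_congr_ae (ae_of_all _ fun q ↦ ?_)
    simp only
    rw [clm_apply_eq_sum]
    refine Finset.sum_congr rfl fun a _ ↦ ?_
    rw [Finset.sum_mul]
    refine Finset.sum_congr rfl fun b _ ↦ ?_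
    simp only [G]
    ring
  rw [lhs, rhs, Finset.mul_sum]
  refine Finset.sum_congr rfl fun a _ ↦ ?_
  rw [hτ.integral_rotPath (hG a) (hGC a) (hGD a) σ a θ, I2 a]
  -- The backward integration by parts: a factor `z b` is traded for `cos θ σ b` and a derivative in
  -- direction `b`. The `cos θ` already present is thus absorbed instead of divided out, so nothing
  -- blows up near `θ = π/2`.
  have I3 : ∀ b, (σ b)⁻¹ * ∫ q, (τ a q.1 b - if a = b then σ a ^ 2 else 0) * q.2 b
          * G a (rotPath F σ θ q) ∂ν
      = Real.cos θ * (∫ q, τ a q.1 b *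
          fderiv ℝ (G a) (rotPath F σ θ q) (EuclideanSpace.single b 1) ∂ν
        - (if a = b then σ a ^ 2 else 0) * H a b) := fun b ↦ by
    rw [integral_weight_mul_eval_mul_rotPath hτ.integrable (hG a) (hGC a) (hGD a) σ b θ (jc a b)]
    simp only [sub_mul]
    rw [integral_sub (jH _ (hτ.integrable_kernel a b) a b) (jH _ (integrable_const _) a b),
      integral_const_mul]
    simp only [H]
    have := hσ b
    field_simp
  simp only [I3]
  rw [← Finset.mul_sum, Finset.sum_sub_distrib]
  simp only [ite_mul, zero_mul, Finset.sum_ite_eq, Finset.mem_univ, if_true]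
  ring

end SteinKernel

/-! ### Gaussian comparison in terms of the Stein discrepancy. -/

section SteinBound

variable {ι : Type*} [Fintype ι]

/-- Cauchy–Schwarz in each row, then the arithmetic–geometric mean inequality. The free weight `l`
makes the bound linear in second moments, so it can be integrated at once and `l` tuned at the end.
-/
theorem norm_matrix_apply_le (D : ι → ι → ℝ) (w : ι → ℝ) {l : ℝ} (hl : 0 < l) :
    ‖(WithLp.toLp 2 fun a ↦ ∑ b, D a b * w b : EuclideanSpace ℝ ι)‖
      ≤ (l * ∑ a, ∑ b, D a b ^ 2 + l⁻¹ * ∑ b, w b ^ 2) / 2 := by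
  set P := ∑ a, ∑ b, D a b ^ 2
  set R := ∑ b, w b ^ 2
  have hP : 0 ≤ P := Finset.sum_nonneg fun a _ ↦ Finset.sum_nonneg fun b _ ↦ sq_nonneg _
  have hR : 0 ≤ R := Finset.sum_nonneg fun b _ ↦ sq_nonneg _
  refine abs_le_of_sq_le_sq' ?_ (by positivity) |>.2
  rw [EuclideanSpace.norm_sq_eq]
  calc ∑ a, ‖∑ b, D a b * w b‖ ^ 2 ≤ ∑ a, (∑ b, D a b ^ 2) * R := by
        refine Finset.sum_le_sum fun a _ ↦ ?_
        rw [Real.norm_eq_abs, sq_abs]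
        exact Finset.sum_mul_sq_le_sq_mul_sq _ _ _
    _ = P * R := by rw [← Finset.sum_mul]
    _ ≤ ((l * P + l⁻¹ * R) / 2) ^ 2 := by
        have : (l * P) * (l⁻¹ * R) = P * R := by field_simp
        nlinarith [sq_nonneg (l * P - l⁻¹ * R)]

variable [DecidableEq ι] {Ω : Type*} [MeasurableSpace Ω] {μ : Measure Ω} [IsProbabilityMeasure μ]

theorem integrable_scaleVec (σ : ι → ℝ) : Integrable (scaleVec σ) (gaussianPi ι) := by
  have : scaleVec σ = fun z ↦ ∑ b, z b • (σ b • EuclideanSpace.single b (1 : ℝ)) := by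
    ext z a; simp [scaleVec, Pi.single_apply, mul_comm]
  rw [this]
  exact integrable_finsetSum _ fun b _ ↦ (integrable_eval_gaussianPi b).smul_const _

theorem LipschitzWith.integrable_comp_of_integrable {E : Type*} [NormedAddCommGroup E]
    {h : E → ℝ} {K : NNReal} (hh : LipschitzWith K h) {F : Ω → E} (hF : Integrable F μ) :
    Integrable (fun ω ↦ h (F ω)) μ := by
  refine ((integrable_const |h 0|).add (hF.norm.const_mul (K : ℝ))).mono'
    (hh.continuous.comp_aestronglyMeasurable hF.1) (ae_of_all _ fun ω ↦ ?_)
  have := hh.dist_le_mul (F ω) 0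
  rw [Real.dist_eq, dist_zero_right] at this
  have h2 := abs_add_le (h (F ω) - h 0) (h 0)
  rw [sub_add_cancel] at h2
  simp only [Pi.add_apply, Real.norm_eq_abs]
  linarith

/-- The discrepancy of a Stein kernel from the covariance of a Gaussian vector. -/
noncomputable def steinDiscrepancy (μ : Measure Ω) (τ : ι → Ω → EuclideanSpace ℝ ι) (σ : ι → ℝ) :
    ℝ :=
  ∑ a, ∑ b, ∫ ω, (τ a ω b - if a = b then σ a ^ 2 else 0) ^ 2 ∂μ

theorem IsSteinKernel.abs_integral_deriv_le {F : Ω → EuclideanSpace ℝ ι}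
    {τ : ι → Ω → EuclideanSpace ℝ ι} (hτ : IsSteinKernel μ F τ) {g : EuclideanSpace ℝ ι → ℝ}
    (hg : ContDiff ℝ 2 g) (hC : ∀ y, ‖fderiv ℝ g y‖ ≤ 1) {D : ℝ}
    (hD : ∀ y, ‖fderiv ℝ (fderiv ℝ g) y‖ ≤ D) {σ : ι → ℝ} (hσ : ∀ b, σ b ≠ 0)
    (hsq : ∀ a b, Integrable (fun ω ↦ (τ a ω b - if a = b then σ a ^ 2 else 0) ^ 2) μ)
    {l : ℝ} (hl : 0 < l) (θ : ℝ) :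
    |∫ q, fderiv ℝ g (rotPath F σ θ q) (Real.cos θ • F q.1 - Real.sin θ • scaleVec σ q.2)
        ∂μ.prod (gaussianPi ι)|
      ≤ (l * steinDiscrepancy μ τ σ + l⁻¹ * ∑ b, (σ b ^ 2)⁻¹) / 2 := by
  rw [hτ.integral_deriv_rotPath hg hC hD hσ θ, abs_mul]
  refine (mul_le_of_le_one_left (abs_nonneg _) (Real.abs_sin_le_one θ)).trans ?_
  set T : ι → ι → Ω → ℝ := fun a b ω ↦ τ a ω b - if a = b then σ a ^ 2 else 0
  have iT : ∀ a ∈ Finset.univ, Integrable (fun q : Ω × (ι → ℝ) ↦ ∑ b, T a b q.1 ^ 2)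
      (μ.prod (gaussianPi ι)) := fun a _ ↦ integrable_finsetSum _ fun b _ ↦
    (hsq a b).comp_fst (gaussianPi ι)
  have iz : ∀ b ∈ Finset.univ, Integrable (fun q : Ω × (ι → ℝ) ↦ (q.2 b / σ b) ^ 2)
      (μ.prod (gaussianPi ι)) := fun b _ ↦ by
    have := (integrable_eval_sq_gaussianPi b).comp_snd (ν := gaussianPi ι) μ
    simpa only [div_pow] using this.div_const (σ b ^ 2)
  have i1 := (integrable_finsetSum _ iT).const_mul l
  have i2 := (integrable_finsetSum _ iz).const_mul l⁻¹
  have key : ∫ q : Ω × (ι → ℝ), (l * ∑ a, ∑ b, T a b q.1 ^ 2 + l⁻¹ * ∑ b, (q.2 b / σ b) ^ 2) / 2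
      ∂μ.prod (gaussianPi ι) = (l * steinDiscrepancy μ τ σ + l⁻¹ * ∑ b, (σ b ^ 2)⁻¹) / 2 := by
    rw [integral_div, integral_add i1 i2, integral_const_mul, integral_const_mul,
      integral_finsetSum _ iT, integral_finsetSum _ iz]
    have e1 : ∑ a, ∫ q : Ω × (ι → ℝ), ∑ b, T a b q.1 ^ 2 ∂μ.prod (gaussianPi ι)
        = steinDiscrepancy μ τ σ := by
      refine Finset.sum_congr rfl fun a _ ↦ ?_
      rw [integral_finsetSum _ fun b _ ↦ (hsq a b).comp_fst (gaussianPi ι)]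
      refine Finset.sum_congr rfl fun b _ ↦ ?_
      have := integral_fun_fst (μ := μ) (ν := gaussianPi ι) fun ω ↦ T a b ω ^ 2
      simpa using this
    have e2 : ∑ b, ∫ q : Ω × (ι → ℝ), (q.2 b / σ b) ^ 2 ∂μ.prod (gaussianPi ι)
        = ∑ b, (σ b ^ 2)⁻¹ := by
      refine Finset.sum_congr rfl fun b _ ↦ ?_
      have := integral_fun_snd (μ := μ) (ν := gaussianPi ι) fun z ↦ (z b / σ b) ^ 2
      rw [this]
      simp only [div_pow]
      rw [integral_div, integral_eval_sq_gaussianPi]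
      simp
    rw [e1, e2]
  rw [← key, ← Real.norm_eq_abs]
  refine norm_integral_le_of_norm_le ((i1.add i2).div_const 2) (ae_of_all _ fun q ↦ ?_)
  refine ((fderiv ℝ g _).le_opNorm _).trans ?_
  refine (mul_le_of_le_one_left (norm_nonneg _) (hC _)).trans ?_
  exact norm_matrix_apply_le (fun a b ↦ T a b q.1) (fun b ↦ q.2 b / σ b) hl

/-- The path joins the Gaussian at `θ = 0` to `F` at `θ = π/2`, and the mean value inequality
applies. The second-derivative bound `D` only justifies the integrations by parts and does not enter
the estimate. -/
theorem IsSteinKernel.abs_integral_sub_le_of_contDiff {F : Ω → EuclideanSpace ℝ ι}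
    {τ : ι → Ω → EuclideanSpace ℝ ι} (hτ : IsSteinKernel μ F τ) {g : EuclideanSpace ℝ ι → ℝ}
    (hg : ContDiff ℝ 2 g) (hL : LipschitzWith 1 g) {D : ℝ}
    (hD : ∀ y, ‖fderiv ℝ (fderiv ℝ g) y‖ ≤ D) {σ : ι → ℝ} (hσ : ∀ b, σ b ≠ 0)
    (hsq : ∀ a b, Integrable (fun ω ↦ (τ a ω b - if a = b then σ a ^ 2 else 0) ^ 2) μ)
    {l : ℝ} (hl : 0 < l) :
    |∫ ω, g (F ω) ∂μ - ∫ z, g (scaleVec σ z) ∂gaussianPi ι|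
      ≤ (l * steinDiscrepancy μ τ σ + l⁻¹ * ∑ b, (σ b ^ 2)⁻¹) / 2 * (Real.pi / 2) := by
  have hC : ∀ y, ‖fderiv ℝ g y‖ ≤ 1 := fun y ↦ by
    simpa using norm_fderiv_le_of_lipschitz ℝ hL (x₀ := y)
  set ν := μ.prod (gaussianPi ι)
  set φ : ℝ → ℝ := fun θ ↦ ∫ q, g (rotPath F σ θ q) ∂ν
  have iF : Integrable (fun q : Ω × (ι → ℝ) ↦ F q.1) ν := hτ.integrable.comp_fst _
  have iN : Integrable (fun q : Ω × (ι → ℝ) ↦ scaleVec σ q.2) ν :=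
    (integrable_scaleVec σ).comp_snd μ
  have iY : ∀ θ, Integrable (rotPath F σ θ) ν := fun θ ↦
    (iF.smul (Real.sin θ)).add (iN.smul (Real.cos θ))
  have hgm : ∀ θ, Integrable (fun q ↦ g (rotPath F σ θ q)) ν := fun θ ↦
    hL.integrable_comp_of_integrable (iY θ)
  have hφ : ∀ θ, HasDerivAt φ (∫ q, fderiv ℝ g (rotPath F σ θ q)
      (Real.cos θ • F q.1 - Real.sin θ • scaleVec σ q.2) ∂ν) θ := fun θ ↦ by
    refine (hasDerivAt_integral_of_dominated_loc_of_deriv_le (s := Set.univ)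
      (F' := fun θ q ↦ fderiv ℝ g (rotPath F σ θ q)
        (Real.cos θ • F q.1 - Real.sin θ • scaleVec σ q.2))
      (bound := fun q ↦ ‖F q.1‖ + ‖scaleVec σ q.2‖) Filter.univ_mem
      (Filter.Eventually.of_forall fun t ↦ (hgm t).1) (hgm θ) ?_ ?_ ?_ ?_).2
    · have h1 : AEStronglyMeasurable (fun q ↦ fderiv ℝ g (rotPath F σ θ q)) ν :=
        (hg.continuous_fderiv (by norm_num)).comp_aestronglyMeasurable (iY θ).1
      exact (ContinuousLinearMap.id ℝ (EuclideanSpace ℝ ι →L[ℝ] ℝ)).aestronglyMeasurable_comp₂ h1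
        ((iF.smul (Real.cos θ)).sub (iN.smul (Real.sin θ))).1
    · refine ae_of_all _ fun q t _ ↦ ?_
      refine ((fderiv ℝ g _).le_opNorm _).trans ?_
      refine (mul_le_of_le_one_left (norm_nonneg _) (hC _)).trans ?_
      refine (norm_sub_le _ _).trans (add_le_add ?_ ?_)
      · rw [norm_smul]
        exact mul_le_of_le_one_left (norm_nonneg _) (Real.abs_cos_le_one t)
      · rw [norm_smul]
        exact mul_le_of_le_one_left (norm_nonneg _) (Real.abs_sin_le_one t)
    · exact iF.norm.add iN.norm
    · refine ae_of_all _ fun q t _ ↦ ?_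
      have h1 : HasDerivAt (fun t ↦ rotPath F σ t q)
          (Real.cos t • F q.1 - Real.sin t • scaleVec σ q.2) t := by
        have := ((Real.hasDerivAt_sin t).smul_const (F q.1)).add
          ((Real.hasDerivAt_cos t).smul_const (scaleVec σ q.2))
        refine this.congr_deriv ?_
        rw [neg_smul, sub_eq_add_neg]
      exact (hg.differentiable (by norm_num)).differentiableAt.hasFDerivAt.comp_hasDerivAt t h1
  have h0 : φ 0 = ∫ z, g (scaleVec σ z) ∂gaussianPi ι := by
    have := integral_fun_snd (μ := μ) (ν := gaussianPi ι) fun z ↦ g (scaleVec σ z)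
    simpa [φ, rotPath] using this
  have h1 : φ (Real.pi / 2) = ∫ ω, g (F ω) ∂μ := by
    have := integral_fun_fst (μ := μ) (ν := gaussianPi ι) fun ω ↦ g (F ω)
    simpa [φ, rotPath] using this
  have := Convex.norm_image_sub_le_of_norm_hasDerivWithin_le (f := φ) (s := Set.univ)
    (fun θ _ ↦ (hφ θ).hasDerivWithinAt)
    (fun θ _ ↦ hτ.abs_integral_deriv_le hg hC hD hσ hsq hl θ) convex_univ
    (Set.mem_univ 0) (Set.mem_univ (Real.pi / 2))
  rw [h0, h1, Real.norm_eq_abs, sub_zero, Real.norm_eq_abs,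
    abs_of_pos (by positivity : (0 : ℝ) < Real.pi / 2)] at this
  exact this

/-- Comparison of a random vector having a Stein kernel with a Gaussian vector with independent
coordinates, for Lipschitz test functions. -/
theorem IsSteinKernel.abs_integral_sub_le {F : Ω → EuclideanSpace ℝ ι}
    {τ : ι → Ω → EuclideanSpace ℝ ι} (hτ : IsSteinKernel μ F τ) {h : EuclideanSpace ℝ ι → ℝ}
    (hh : LipschitzWith 1 h) {σ : ι → ℝ} (hσ : ∀ b, σ b ≠ 0)
    (hsq : ∀ a b, Integrable (fun ω ↦ (τ a ω b - if a = b then σ a ^ 2 else 0) ^ 2) μ)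
    {l : ℝ} (hl : 0 < l) :
    |∫ ω, h (F ω) ∂μ - ∫ z, h (scaleVec σ z) ∂gaussianPi ι|
      ≤ (l * steinDiscrepancy μ τ σ + l⁻¹ * ∑ b, (σ b ^ 2)⁻¹) / 2 * (Real.pi / 2) := by
  refine le_of_forall_pos_le_add fun ε hε ↦ ?_
  -- `M` may grow as `ε` shrinks; this is harmless because the smooth estimate is independent of it.
  obtain ⟨g, hg, hgL, ⟨M, hM⟩, hgh⟩ := hh.exists_contDiff_approx (half_pos hε)
  have key := hτ.abs_integral_sub_le_of_contDiff hg hgL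
    (fun y ↦ norm_fderiv_le_of_lipschitz ℝ hM (x₀ := y)) hσ hsq hl
  have e1 : |∫ ω, g (F ω) ∂μ - ∫ ω, h (F ω) ∂μ| ≤ ε / 2 := by
    rw [← integral_sub (hgL.integrable_comp_of_integrable hτ.integrable)
      (hh.integrable_comp_of_integrable hτ.integrable), ← Real.norm_eq_abs]
    simpa using norm_integral_le_of_norm_le_const (μ := μ) (C := ε / 2)
      (f := fun ω ↦ g (F ω) - h (F ω)) (ae_of_all _ fun ω ↦ hgh (F ω))
  have e2 : |∫ z, g (scaleVec σ z) ∂gaussianPi ι - ∫ z, h (scaleVec σ z) ∂gaussianPi ι|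
      ≤ ε / 2 := by
    rw [← integral_sub (hgL.integrable_comp_of_integrable (integrable_scaleVec σ))
      (hh.integrable_comp_of_integrable (integrable_scaleVec σ)), ← Real.norm_eq_abs]
    simpa using norm_integral_le_of_norm_le_const (μ := gaussianPi ι) (C := ε / 2)
      (f := fun z ↦ g (scaleVec σ z) - h (scaleVec σ z)) (ae_of_all _ fun z ↦ hgh (scaleVec σ z))
  rw [abs_le] at key e1 e2 ⊢
  constructor <;> linarith [key.1, key.2, e1.1, e1.2, e2.1, e2.2]

end SteinBound

/-! ### The linearized Wishart vector and its Stein kernel. -/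

section WishartKernel

variable {p m : ℕ}

/-- The row of a position in the upper triangular part. -/
def UpIndex.row (α : UpIndex p) : Fin p := Sum.elim id (fun ij ↦ ij.1.1) α

/-- The column of a position in the upper triangular part. -/
def UpIndex.col (α : UpIndex p) : Fin p := Sum.elim id (fun ij ↦ ij.1.2) α

theorem upVec_apply (G : Matrix (Fin p) (Fin p) ℝ) (α : UpIndex p) :
    upVec G α = G α.row α.col := by
  rcases α with a | ij <;> rfl

theorem UpIndex.row_le_col (α : UpIndex p) : α.row ≤ α.col := by
  rcases α with a | ⟨⟨a, b⟩, h⟩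
  · exact le_rfl
  · exact le_of_lt h

theorem UpIndex.eq_of_row_eq_of_col_eq {α β : UpIndex p} (h : α.row = β.row)
    (h' : α.col = β.col) : α = β := by
  rcases α with a | ⟨⟨a, b⟩, hab⟩ <;> rcases β with c | ⟨⟨c, d⟩, hcd⟩
  · exact congrArg _ h
  · have h1 : a = c := h
    have h2 : a = d := h'
    exact absurd (h1.symm.trans h2) (ne_of_lt hcd)
  · have h1 : a = c := h
    have h2 : b = c := h'
    exact absurd (h1.trans h2.symm) (ne_of_lt hab)
  · have h1 : a = c := h
    have h2 : b = d := h'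
    subst h1 h2
    rfl

theorem UpIndex.sum_le {f : Fin p → Fin p → ℝ} (hf : ∀ a b, 0 ≤ f a b) :
    ∑ α : UpIndex p, f α.row α.col ≤ ∑ a, ∑ b, f a b := by
  rw [← Fintype.sum_prod_type']
  have hinj : Function.Injective fun α : UpIndex p ↦ (α.row, α.col) := fun α β e ↦
    UpIndex.eq_of_row_eq_of_col_eq (congrArg Prod.fst e) (congrArg Prod.snd e)
  calc ∑ α : UpIndex p, f α.row α.col
      = ∑ q ∈ Finset.univ.image fun α : UpIndex p ↦ (α.row, α.col), f q.1 q.2 := by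
        rw [Finset.sum_image fun _ _ _ _ h ↦ hinj h]
    _ ≤ _ := Finset.sum_le_sum_of_subset_of_nonneg (Finset.subset_univ _) fun _ _ _ ↦ hf _ _

/-- The standard deviations of the limiting Gaussian vector. -/
noncomputable def limitScale (p : ℕ) : UpIndex p → ℝ :=
  Sum.elim (fun _ ↦ √(1 / 2)) (fun _ ↦ 1 / 2)

theorem limitScale_pos (α : UpIndex p) : 0 < limitScale p α := by
  rcases α with a | a <;> simp [limitScale]

theorem limitScale_sq (α : UpIndex p) :
    limitScale p α ^ 2 = Sum.elim (fun _ ↦ 1 / 2) (fun _ ↦ 1 / 4) α := by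
  rcases α with a | a
  · simp [limitScale]
  · norm_num [limitScale]

theorem sum_inv_limitScale_sq_le : ∑ α, (limitScale p α ^ 2)⁻¹ ≤ 4 * (p : ℝ) ^ 2 := by
  calc ∑ α, (limitScale p α ^ 2)⁻¹ ≤ ∑ α : UpIndex p, (4 : ℝ) := by
        refine Finset.sum_le_sum fun α _ ↦ ?_
        rw [limitScale_sq]
        rcases α with a | a <;> norm_num
    _ ≤ ∑ a : Fin p, ∑ b : Fin p, (4 : ℝ) :=
        UpIndex.sum_le (f := fun _ _ ↦ (4 : ℝ)) fun _ _ ↦ by norm_num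
    _ = 4 * (p : ℝ) ^ 2 := by simp; ring

/-- `X ↦ ∑ i, X i (X i)ᵀ - m I`, with the rows of `X` indexed by the sample. -/
def centeredGram (x : Fin m × Fin p → ℝ) : Matrix (Fin p) (Fin p) ℝ :=
  fun a b ↦ ∑ i, x (i, a) * x (i, b) - if a = b then (m : ℝ) else 0

theorem continuous_centeredGram (a b : Fin p) :
    Continuous fun x : Fin m × Fin p → ℝ ↦ centeredGram x a b := by
  unfold centeredGram; fun_prop

theorem hasPolyGrowth_centeredGram (a b : Fin p) :
    HasPolyGrowth fun x : Fin m × Fin p → ℝ ↦ centeredGram x a b :=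
  (HasPolyGrowth.sum _ fun i _ ↦ (HasPolyGrowth.eval (i, a)).mul (.eval (i, b))).sub (.const _)

theorem hasDerivAt_update_apply {κ : Type*} [DecidableEq κ] (x : κ → ℝ) (k j : κ) (t : ℝ) :
    HasDerivAt (fun s ↦ Function.update x k s j) (if j = k then 1 else 0) t := by
  by_cases h : j = k
  · subst h; simpa using hasDerivAt_id' t
  · simpa [h] using hasDerivAt_const t (x j)

/-- The derivative of `centeredGram x b d` with respect to `x k`. -/
def gramDeriv (k : Fin m × Fin p) (b d : Fin p) (x : Fin m × Fin p → ℝ) : ℝ :=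
  (if b = k.2 then x (k.1, d) else 0) + if d = k.2 then x (k.1, b) else 0

theorem continuous_gramDeriv (k : Fin m × Fin p) (b d : Fin p) : Continuous (gramDeriv k b d) := by
  unfold gramDeriv
  split_ifs <;> fun_prop

theorem hasPolyGrowth_gramDeriv (k : Fin m × Fin p) (b d : Fin p) :
    HasPolyGrowth (gramDeriv k b d) := by
  unfold gramDeriv
  refine .add ?_ ?_ <;> split_ifs <;> first | exact .const 0 | exact .eval _

theorem hasDerivAt_centeredGram (k : Fin m × Fin p) (b d : Fin p) (x : Fin m × Fin p → ℝ) (t : ℝ) :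
    HasDerivAt (fun s ↦ centeredGram (Function.update x k s) b d)
      (gramDeriv k b d (Function.update x k t)) t := by
  have h := (HasDerivAt.fun_sum (u := Finset.univ) fun i _ ↦
    (hasDerivAt_update_apply x k (i, b) t).fun_mul (hasDerivAt_update_apply x k (i, d) t)).sub_const
      (if b = d then (m : ℝ) else 0)
  refine h.congr_deriv ?_
  obtain ⟨i, a⟩ := k
  simp only [Prod.mk.injEq, ite_mul, mul_ite, one_mul, zero_mul, mul_one, mul_zero,
    Finset.sum_add_distrib, ite_and, gramDeriv, Finset.sum_ite_eq', Finset.mem_univ, if_true]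

/-- Gaussian integration by parts against the entries of a centered Gram matrix. -/
theorem integral_centeredGram_mul {H : (Fin m × Fin p → ℝ) → ℝ}
    {H' : Fin m × Fin p → (Fin m × Fin p → ℝ) → ℝ}
    (hH : ∀ k x t, HasDerivAt (fun s ↦ H (Function.update x k s)) (H' k (Function.update x k t)) t)
    (hc : Continuous H) (hc' : ∀ k, Continuous (H' k)) (hg : HasPolyGrowth H)
    (hg' : ∀ k, HasPolyGrowth (H' k)) (a b : Fin p) :
    ∫ x, centeredGram x a b * H x ∂gaussianPi (Fin m × Fin p)
      = ∫ x, ∑ i, x (i, b) * H' (i, a) x ∂gaussianPi (Fin m × Fin p) := by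
  set γ := gaussianPi (Fin m × Fin p)
  have iH : Integrable H γ := hg.integrable hc.aestronglyMeasurable
  have i2 : ∀ i : Fin m, Integrable (fun x ↦ x (i, b) * H x) γ := fun i ↦
    ((HasPolyGrowth.eval _).mul hg).integrable (by fun_prop : Continuous _).aestronglyMeasurable
  have i3 : ∀ i : Fin m, Integrable (fun x ↦ x (i, a) * (x (i, b) * H x)) γ := fun i ↦
    ((HasPolyGrowth.eval _).mul ((HasPolyGrowth.eval _).mul hg)).integrable
      (by fun_prop : Continuous _).aestronglyMeasurable
  have i4 : ∀ i : Fin m, Integrable (fun x ↦ x (i, b) * H' (i, a) x) γ := fun i ↦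
    ((HasPolyGrowth.eval _).mul (hg' _)).integrable
      (by have := hc' (i, a); fun_prop : Continuous _).aestronglyMeasurable
  have i5 : Integrable (fun x ↦ (if a = b then (1 : ℝ) else 0) * H x) γ := iH.const_mul _
  -- Only `x (i, a)` is used as Gaussian weight. Differentiating the factor `x (i, b)` produces `H`
  -- when `a = b`; summed over `i`, this is exactly cancelled by the centering `m`.
  have ibp : ∀ i : Fin m, ∫ x, x (i, a) * (x (i, b) * H x) ∂γ
      = ∫ x, ((if a = b then 1 else 0) * H x + x (i, b) * H' (i, a) x) ∂γ := fun i ↦ by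
    refine integral_eval_mul_gaussianPi (i, a) (fun x t ↦ ?_) (i2 i) (i3 i) (i5.add (i4 i))
    refine ((hasDerivAt_update_apply x (i, a) (i, b) t).fun_mul (hH (i, a) x t)).congr_deriv ?_
    simp [eq_comm]
  have e : ∀ x : Fin m × Fin p → ℝ, centeredGram x a b * H x
      = ∑ i : Fin m, (x (i, a) * (x (i, b) * H x) - (if a = b then 1 else 0) * H x) := fun x ↦ by
    rw [Finset.sum_sub_distrib, Finset.sum_const, Finset.card_univ, Fintype.card_fin, centeredGram,
      sub_mul, Finset.sum_mul]
    congr 1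
    · exact Finset.sum_congr rfl fun i _ ↦ by ring
    · split_ifs <;> simp
  simp only [e]
  have i6 : ∀ i ∈ Finset.univ, Integrable (fun x : Fin m × Fin p → ℝ ↦
      x (i, a) * (x (i, b) * H x) - (if a = b then 1 else 0) * H x) γ := fun i _ ↦ (i3 i).sub i5
  rw [integral_finsetSum _ i6, integral_finsetSum _ fun i _ ↦ i4 i]
  refine Finset.sum_congr rfl fun i _ ↦ ?_
  rw [integral_sub (i3 i) i5, ibp i, integral_add i5 (i4 i)]
  ring

theorem integrable_centeredGram_sq (a b : Fin p) :
    Integrable (fun x : Fin m × Fin p → ℝ ↦ centeredGram x a b ^ 2) (gaussianPi _) :=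
  ((hasPolyGrowth_centeredGram a b).pow 2).integrable
    ((continuous_centeredGram a b).pow 2).aestronglyMeasurable

/-- Integration by parts of the entry against itself leaves `E ∑ i, x (i, b) ^ 2 = m` off the
diagonal and twice that on it. -/
theorem integral_centeredGram_sq_le (a b : Fin p) :
    ∫ x, centeredGram x a b ^ 2 ∂gaussianPi (Fin m × Fin p) ≤ 2 * m := by
  have h := integral_centeredGram_mul (m := m) (H' := fun k ↦ gramDeriv k a b)
    (fun k x t ↦ hasDerivAt_centeredGram k a b x t) (continuous_centeredGram a b)
    (fun k ↦ continuous_gramDeriv k a b) (hasPolyGrowth_centeredGram a b)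
    (fun k ↦ hasPolyGrowth_gramDeriv k a b) a b
  simp only [← pow_two] at h
  rw [h]
  have hi : ∀ i : Fin m, Integrable (fun x : Fin m × Fin p → ℝ ↦ 2 * x (i, b) ^ 2) (gaussianPi _) :=
    fun i ↦ (integrable_eval_sq_gaussianPi _).const_mul 2
  have hj : ∀ i : Fin m, Integrable (fun x : Fin m × Fin p → ℝ ↦
      x (i, b) * gramDeriv (i, a) a b x) (gaussianPi _) := fun i ↦
    ((HasPolyGrowth.eval (i, b)).mul (hasPolyGrowth_gramDeriv (i, a) a b)).integrable
      ((continuous_apply _).mul (continuous_gramDeriv _ _ _)).aestronglyMeasurable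
  calc _ ≤ ∫ x : Fin m × Fin p → ℝ, ∑ i : Fin m, 2 * x (i, b) ^ 2
        ∂gaussianPi (Fin m × Fin p) := by
        refine integral_mono (integrable_finsetSum _ fun i _ ↦ hj i)
          (integrable_finsetSum _ fun i _ ↦ hi i) fun x ↦ Finset.sum_le_sum fun i _ ↦ ?_
        simp only [gramDeriv, if_true]
        split_ifs with hab
        · subst hab; nlinarith
        · nlinarith [sq_nonneg (x (i, b))]
    _ = 2 * (m : ℝ) := by
        rw [integral_finsetSum _ fun i _ ↦ hi i]
        simp only [integral_const_mul, integral_eval_sq_gaussianPi]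
        simp [mul_comm]

/-- The linearization `(W - m I)_up / (2 √m)` of the vector `(W^{1/2} - √m I)_up`. -/
noncomputable def wishartLin (x : Fin m × Fin p → ℝ) : EuclideanSpace ℝ (UpIndex p) :=
  upVec ((2 * √(m : ℝ))⁻¹ • centeredGram x)

/-- A Stein kernel of `wishartLin`. -/
noncomputable def wishartKernel (α : UpIndex p) (x : Fin m × Fin p → ℝ) :
    EuclideanSpace ℝ (UpIndex p) :=
  WithLp.toLp 2 fun β ↦ (2 * √(m : ℝ))⁻¹ *
    ∑ i, x (i, α.col) * ((2 * √(m : ℝ))⁻¹ * gramDeriv (i, α.row) β.row β.col x)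

theorem wishartLin_apply (x : Fin m × Fin p → ℝ) (α : UpIndex p) :
    wishartLin x α = (2 * √(m : ℝ))⁻¹ * centeredGram x α.row α.col := by
  rw [wishartLin, upVec_apply]; rfl

theorem continuous_wishartLin : Continuous (wishartLin : (Fin m × Fin p → ℝ) → _) := by
  have : (wishartLin : (Fin m × Fin p → ℝ) → _) = fun x ↦ WithLp.toLp 2 fun α : UpIndex p ↦
      (2 * √(m : ℝ))⁻¹ * centeredGram x α.row α.col := by
    ext x α; exact wishartLin_apply x α
  rw [this]
  have := fun α : UpIndex p ↦ continuous_centeredGram (m := m) α.row α.col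
  fun_prop

theorem integrable_wishartLin :
    Integrable (wishartLin : (Fin m × Fin p → ℝ) → _) (gaussianPi _) := by
  have : (wishartLin : (Fin m × Fin p → ℝ) → _) = fun x ↦ ∑ α : UpIndex p,
      ((2 * √(m : ℝ))⁻¹ * centeredGram x α.row α.col) • EuclideanSpace.single α (1 : ℝ) := by
    ext x α; simp [wishartLin_apply, Pi.single_apply, -Fintype.sum_sum_type]
  rw [this]
  exact integrable_finsetSum _ fun α _ ↦ (((hasPolyGrowth_centeredGram _ _).integrable
    (continuous_centeredGram _ _).aestronglyMeasurable).const_mul _).smul_const _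

theorem hasDerivAt_wishartLin (k : Fin m × Fin p) (x : Fin m × Fin p → ℝ) (t : ℝ) :
    HasDerivAt (fun s ↦ wishartLin (Function.update x k s))
      (WithLp.toLp 2 fun β : UpIndex p ↦
        (2 * √(m : ℝ))⁻¹ * gramDeriv k β.row β.col (Function.update x k t)) t := by
  have h : HasDerivAt (fun s ↦ fun β : UpIndex p ↦
      (2 * √(m : ℝ))⁻¹ * centeredGram (Function.update x k s) β.row β.col)
      (fun β : UpIndex p ↦
        (2 * √(m : ℝ))⁻¹ * gramDeriv k β.row β.col (Function.update x k t)) t :=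
    hasDerivAt_pi.2 fun β ↦ (hasDerivAt_centeredGram k β.row β.col x t).const_mul _
  have h2 := (PiLp.continuousLinearEquiv 2 ℝ fun _ : UpIndex p ↦ ℝ).symm.toContinuousLinearMap
    |>.hasFDerivAt.comp_hasDerivAt t h
  refine (h2.congr_deriv rfl).congr_of_eventuallyEq (Filter.Eventually.of_forall fun s ↦ ?_)
  ext β
  exact wishartLin_apply _ β

/-- Integration by parts in the array with `H = G ∘ wishartLin`; the chain rule collects the partial
derivatives of `wishartLin` into the kernel rows. -/
theorem isSteinKernel_wishartKernel :
    IsSteinKernel (gaussianPi (Fin m × Fin p)) wishartLin wishartKernel where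
  integrable := integrable_wishartLin
  integrable_kernel α β := by
    have h : HasPolyGrowth fun x : Fin m × Fin p → ℝ ↦ wishartKernel α x β :=
      (HasPolyGrowth.const _).mul (.sum _ fun i _ ↦ (HasPolyGrowth.eval _).mul
        ((HasPolyGrowth.const _).mul (hasPolyGrowth_gramDeriv _ _ _)))
    refine h.integrable (Continuous.aestronglyMeasurable ?_)
    have := fun i : Fin m ↦ continuous_gramDeriv (i, α.row) β.row β.col
    unfold wishartKernel
    fun_prop
  integral_eq α G hG hC hD := by
    obtain ⟨C, hC⟩ := hC
    obtain ⟨D, hD⟩ := hD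
    have hGd := hG.continuous_fderiv one_ne_zero
    have hF := continuous_wishartLin (m := m) (p := p)
    have hgd := fun (k : Fin m × Fin p) (β : UpIndex p) ↦ continuous_gramDeriv k β.row β.col
    have h := integral_centeredGram_mul (m := m) (p := p) (H := fun x ↦ G (wishartLin x))
      (H' := fun k x ↦ fderiv ℝ G (wishartLin x) (WithLp.toLp 2 fun β : UpIndex p ↦
        (2 * √(m : ℝ))⁻¹ * gramDeriv k β.row β.col x))
      (fun k x t ↦ (hG.differentiable one_ne_zero).differentiableAt.hasFDerivAt.comp_hasDerivAt t
        (hasDerivAt_wishartLin k x t))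
      (hG.continuous.comp hF)
      (fun k ↦ by
        have := hgd k
        fun_prop)
      (.of_bound fun x ↦ hC _)
      (fun k ↦ by
        have e := fun x : Fin m × Fin p → ℝ ↦ clm_apply_eq_sum (fderiv ℝ G (wishartLin x))
          (WithLp.toLp 2 fun β : UpIndex p ↦ (2 * √(m : ℝ))⁻¹ * gramDeriv k β.row β.col x)
        rw [funext e]
        exact .sum _ fun β _ ↦ ((HasPolyGrowth.const _).mul (hasPolyGrowth_gramDeriv _ _ _)).mul
          (.of_bound fun x ↦ abs_fderiv_single_le hD β _))
      α.row α.col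
    simp only [wishartLin_apply, mul_assoc]
    rw [integral_const_mul, h, ← integral_const_mul]
    refine integral_congr_ae (ae_of_all _ fun x ↦ ?_)
    simp only
    have : wishartKernel α x = (2 * √(m : ℝ))⁻¹ • ∑ i, x (i, α.col) •
        (WithLp.toLp 2 fun β : UpIndex p ↦
          (2 * √(m : ℝ))⁻¹ * gramDeriv (i, α.row) β.row β.col x) := by
      ext β
      simp [wishartKernel]
    rw [this]
    simp

/-- The derivative of a Gram entry is linear in the sample row, so pairing it with `x (i, α.col)`
and summing over `i` gives Gram entries again. The limiting covariance supplies precisely their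
centering: a diagonal position matches both terms, hence `1/2`, and an off-diagonal one a single
term, hence `1/4`. -/
theorem wishartKernel_sub (hm : m ≠ 0) (α β : UpIndex p) (x : Fin m × Fin p → ℝ) :
    wishartKernel α x β - (if α = β then limitScale p α ^ 2 else 0)
      = (4 * (m : ℝ))⁻¹ * ((if α.row = β.row then centeredGram x α.col β.col else 0)
        + if α.row = β.col then centeredGram x α.col β.row else 0) := by
  have hm' : (0 : ℝ) < m := by exact_mod_cast Nat.pos_of_ne_zero hm
  have h1 : wishartKernel α x β = (4 * (m : ℝ))⁻¹ *
      ((if α.row = β.row then ∑ i, x (i, α.col) * x (i, β.col) else 0)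
        + if α.row = β.col then ∑ i, x (i, α.col) * x (i, β.row) else 0) := by
    have h4 : (4 * (m : ℝ))⁻¹ = (2 * √(m : ℝ))⁻¹ * (2 * √(m : ℝ))⁻¹ := by
      rw [← mul_inv]
      congr 1
      nlinarith [Real.mul_self_sqrt hm'.le]
    rw [h4, mul_assoc]
    simp only [wishartKernel, gramDeriv]
    congr 1
    have e : ∀ i : Fin m, x (i, α.col) * ((2 * √(m : ℝ))⁻¹ *
        ((if β.row = α.row then x (i, β.col) else 0) + if β.col = α.row then x (i, β.row) else 0))
        = (2 * √(m : ℝ))⁻¹ * (x (i, α.col) *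
        ((if β.row = α.row then x (i, β.col) else 0) + if β.col = α.row then x (i, β.row) else 0)) :=
      fun i ↦ by ring
    simp only [e]
    rw [← Finset.mul_sum]
    congr 1
    simp only [mul_add, Finset.sum_add_distrib]
    congr 1 <;> split_ifs <;> first | rfl | grind | simp
  have h2 : (if α = β then limitScale p α ^ 2 else 0) = (4 * (m : ℝ))⁻¹ *
      ((if α.row = β.row then if α.col = β.col then (m : ℝ) else 0 else 0)
        + if α.row = β.col then if α.col = β.row then (m : ℝ) else 0 else 0) := by
    rw [limitScale_sq]
    by_cases hαβ : α = β
    · subst hαβ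
      rcases α with a | ⟨⟨a, b⟩, hab⟩
      · simp only [UpIndex.row, UpIndex.col, Sum.elim_inl, id, if_true]
        field_simp
        norm_num
      · have : a ≠ b := ne_of_lt hab
        simp only [UpIndex.row, UpIndex.col, Sum.elim_inr, if_true, this, if_false, add_zero]
        field_simp
    · have h1 : ¬(α.row = β.row ∧ α.col = β.col) := fun h ↦
        hαβ (UpIndex.eq_of_row_eq_of_col_eq h.1 h.2)
      -- Two upper triangular positions that are transposes of each other are on the diagonal and
      -- therefore equal.
      have h2 : ¬(α.row = β.col ∧ α.col = β.row) := fun h ↦ by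
        have e1 := α.row_le_col
        have e2 := β.row_le_col
        rw [h.1, h.2] at e1
        have e3 := le_antisymm e1 e2
        exact h1 ⟨h.1.trans e3, h.2.trans e3.symm⟩
      simp only [← ite_and, hαβ, h1, h2, if_false, add_zero, mul_zero]
  rw [h1, h2, ← mul_sub]
  congr 1
  simp only [centeredGram]
  split_ifs <;> ring

theorem integrable_wishartKernel_sub_sq (hm : m ≠ 0) (α β : UpIndex p) :
    Integrable (fun x : Fin m × Fin p → ℝ ↦
      (wishartKernel α x β - if α = β then limitScale p α ^ 2 else 0) ^ 2) (gaussianPi _) := by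
  simp_rw [wishartKernel_sub hm]
  have h1 := hasPolyGrowth_centeredGram (m := m) α.col β.col
  have h2 := hasPolyGrowth_centeredGram (m := m) α.col β.row
  have c1 := continuous_centeredGram (m := m) α.col β.col
  have c2 := continuous_centeredGram (m := m) α.col β.row
  refine (((HasPolyGrowth.const _).mul (.add ?_ ?_)).pow 2).integrable
    (Continuous.aestronglyMeasurable ?_)
  · split_ifs
    exacts [h1, .const 0]
  · split_ifs
    exacts [h2, .const 0]
  · split_ifs <;> fun_prop

/-- An entry of the deviation vanishes unless `α.row` equals `β.row` or `β.col`. Each of these two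
coincidences holds for `p³` of the `p⁴` index quadruples and costs `1/(4m)`. -/
theorem steinDiscrepancy_wishartKernel_le (hm : m ≠ 0) :
    steinDiscrepancy (gaussianPi (Fin m × Fin p)) wishartKernel (limitScale p)
      ≤ (p : ℝ) ^ 3 / (2 * m) := by
  have hm' : (0 : ℝ) < m := by exact_mod_cast Nat.pos_of_ne_zero hm
  have bound : ∀ α β : UpIndex p, ∫ x : Fin m × Fin p → ℝ,
      (wishartKernel α x β - if α = β then limitScale p α ^ 2 else 0) ^ 2 ∂gaussianPi _
      ≤ (4 * (m : ℝ))⁻¹ *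
        ((if α.row = β.row then 1 else 0) + if α.row = β.col then 1 else 0) := fun α β ↦ by
    set c1 : ℝ := if α.row = β.row then 1 else 0
    set c2 : ℝ := if α.row = β.col then 1 else 0
    have i1 := (integrable_centeredGram_sq (m := m) α.col β.col).const_mul c1
    have i2 := (integrable_centeredGram_sq (m := m) α.col β.row).const_mul c2
    calc _ ≤ ∫ x : Fin m × Fin p → ℝ, (8 * (m : ℝ) ^ 2)⁻¹ * (c1 * centeredGram x α.col β.col ^ 2
          + c2 * centeredGram x α.col β.row ^ 2) ∂gaussianPi _ := by
          refine integral_mono (integrable_wishartKernel_sub_sq hm α β)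
            ((i1.add i2).const_mul _) fun x ↦ ?_
          simp only
          rw [wishartKernel_sub hm, mul_pow]
          -- The factor `2` comes from `(u + v)² ≤ 2 (u² + v²)`.
          have : (8 * (m : ℝ) ^ 2)⁻¹ = ((4 * (m : ℝ))⁻¹) ^ 2 * 2 := by field_simp; norm_num
          rw [this, mul_assoc]
          refine mul_le_mul_of_nonneg_left ?_ (by positivity)
          simp only [c1, c2]
          split_ifs <;> nlinarith [sq_nonneg (centeredGram x α.col β.col),
            sq_nonneg (centeredGram x α.col β.row),
            sq_nonneg (centeredGram x α.col β.col - centeredGram x α.col β.row)]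
      _ ≤ (8 * (m : ℝ) ^ 2)⁻¹ * (c1 * (2 * m) + c2 * (2 * m)) := by
          rw [integral_const_mul, integral_add i1 i2, integral_const_mul, integral_const_mul]
          have h1 : 0 ≤ c1 := by simp only [c1]; split_ifs <;> norm_num
          have h2 : 0 ≤ c2 := by simp only [c2]; split_ifs <;> norm_num
          gcongr
          · exact integral_centeredGram_sq_le _ _
          · exact integral_centeredGram_sq_le _ _
      _ = _ := by field_simp; ring
  calc _ ≤ ∑ α : UpIndex p, ∑ β : UpIndex p, (4 * (m : ℝ))⁻¹ *
        ((if α.row = β.row then 1 else 0) + if α.row = β.col then 1 else 0) :=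
        Finset.sum_le_sum fun α _ ↦ Finset.sum_le_sum fun β _ ↦ bound α β
    _ ≤ ∑ α : UpIndex p, ∑ c : Fin p, ∑ d : Fin p, (4 * (m : ℝ))⁻¹ *
        ((if α.row = c then 1 else 0) + if α.row = d then 1 else 0) :=
        Finset.sum_le_sum fun α _ ↦ UpIndex.sum_le (f := fun c d ↦ (4 * (m : ℝ))⁻¹ *
          ((if α.row = c then 1 else 0) + if α.row = d then 1 else 0)) fun c d ↦ by positivity
    _ ≤ ∑ a : Fin p, ∑ _b : Fin p, ∑ c : Fin p, ∑ d : Fin p, (4 * (m : ℝ))⁻¹ *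
        ((if a = c then 1 else 0) + if a = d then 1 else 0) :=
        UpIndex.sum_le (f := fun a _ ↦ ∑ c : Fin p, ∑ d : Fin p, (4 * (m : ℝ))⁻¹ *
          ((if a = c then 1 else 0) + if a = d then 1 else 0)) fun a b ↦ by positivity
    _ = (p : ℝ) ^ 3 / (2 * m) := by
        simp only [← Finset.mul_sum, Finset.sum_add_distrib, Finset.sum_const, Finset.card_univ,
          Fintype.card_fin, Finset.sum_ite_eq, Finset.mem_univ, if_true, nsmul_eq_mul]
        simp
        field_simp
        ring

end WishartKernel

/-! ### Deterministic linearization of the matrix square root. -/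

section MatrixSqrt

variable {p : ℕ}

/-- The squared Frobenius norm. -/
def sqNorm (A : Matrix (Fin p) (Fin p) ℝ) : ℝ := ∑ i, ∑ j, A i j ^ 2

theorem sqNorm_nonneg (A : Matrix (Fin p) (Fin p) ℝ) : 0 ≤ sqNorm A :=
  Finset.sum_nonneg fun _ _ ↦ Finset.sum_nonneg fun _ _ ↦ sq_nonneg _

theorem sqNorm_smul (c : ℝ) (A : Matrix (Fin p) (Fin p) ℝ) : sqNorm (c • A) = c ^ 2 * sqNorm A := by
  simp [sqNorm, mul_pow, Finset.mul_sum]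

theorem sqNorm_mul_le (A B : Matrix (Fin p) (Fin p) ℝ) :
    sqNorm (A * B) ≤ sqNorm A * sqNorm B := by
  calc sqNorm (A * B) ≤ ∑ i, ∑ j, (∑ k, A i k ^ 2) * ∑ k, B k j ^ 2 :=
        Finset.sum_le_sum fun i _ ↦ Finset.sum_le_sum fun j _ ↦ by
          rw [Matrix.mul_apply]; exact Finset.sum_mul_sq_le_sq_mul_sq _ _ _
    _ = sqNorm A * sqNorm B := by
        rw [sqNorm, sqNorm, Finset.sum_comm (f := fun i j ↦ B i j ^ 2), Finset.sum_mul]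
        simp only [Finset.mul_sum]

theorem norm_upVec_sq_le (A : Matrix (Fin p) (Fin p) ℝ) : ‖upVec A‖ ^ 2 ≤ sqNorm A := by
  rw [EuclideanSpace.norm_sq_eq]
  simp only [upVec_apply, Real.norm_eq_abs, sq_abs]
  exact UpIndex.sum_le (f := fun a b ↦ A a b ^ 2) fun _ _ ↦ sq_nonneg _

/-- For each row `v` of `B`, the cross term in the expansion of `‖vA + r v‖²` is `2r` times the
quadratic form of `A` at `v`, hence nonnegative. -/
theorem Matrix.PosSemidef.sq_mul_sqNorm_le {A : Matrix (Fin p) (Fin p) ℝ} (hA : A.PosSemidef)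
    (B : Matrix (Fin p) (Fin p) ℝ) {r : ℝ} (hr : 0 ≤ r) :
    r ^ 2 * sqNorm B ≤ sqNorm (B * (A + r • 1)) := by
  rw [sqNorm, Finset.mul_sum]
  refine Finset.sum_le_sum fun i _ ↦ ?_
  have h := hA.dotProduct_mulVec_nonneg (B i)
  have e : ∀ j, (B * (A + r • 1)) i j = (B * A) i j + r * B i j := fun j ↦ by
    simp [Matrix.mul_add]
  have h' : 0 ≤ ∑ j, (B * A) i j * B i j := by
    have : star (B i) ⬝ᵥ A.mulVec (B i) = ∑ j, (B * A) i j * B i j := by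
      rw [star_trivial, Matrix.dotProduct_mulVec]
      rfl
    rwa [this] at h
  simp only [e]
  have : ∑ j, ((B * A) i j + r * B i j) ^ 2
      = ∑ j, (B * A) i j ^ 2 + 2 * r * ∑ j, (B * A) i j * B i j + r ^ 2 * ∑ j, B i j ^ 2 := by
    simp only [Finset.mul_sum, ← Finset.sum_add_distrib]
    exact Finset.sum_congr rfl fun j _ ↦ by ring
  rw [this]
  have h1 : 0 ≤ ∑ j, (B * A) i j ^ 2 := Finset.sum_nonneg fun _ _ ↦ sq_nonneg _
  have h2 : 0 ≤ 2 * r * ∑ j, (B * A) i j * B i j := by positivity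
  linarith

/-- Error of the linearization of the square root of a positive semidefinite matrix. -/
theorem Matrix.PosSemidef.norm_upVec_sqrt_sub_le {W : Matrix (Fin p) (Fin p) ℝ} (hW : W.PosSemidef)
    {r : ℝ} (hr : 0 < r) :
    ‖upVec (CFC.sqrt W - r • 1) - upVec ((2 * r)⁻¹ • (W - r ^ 2 • 1))‖
      ≤ sqNorm (W - r ^ 2 • 1) / (2 * r ^ 3) := by
  set A := CFC.sqrt W
  have hA : A.PosSemidef := Matrix.nonneg_iff_posSemidef.1 (CFC.sqrt_nonneg W)
  have hAA : A * A = W := CFC.sqrt_mul_sqrt_self W hW.nonneg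
  have e1 : W - r ^ 2 • 1 = (A - r • 1) * (A + r • 1) := by
    rw [← hAA]
    simp only [Matrix.mul_add, Matrix.sub_mul, Matrix.smul_mul, Matrix.mul_smul, Matrix.one_mul,
      Matrix.mul_one, smul_sub, smul_smul, pow_two]
    abel
  -- Factor `A - r` out on the left and use `2r - (A + r) = -(A - r)`.
  have e2 : (A - r • 1) - (2 * r)⁻¹ • (W - r ^ 2 • 1)
      = (-(2 * r)⁻¹) • ((A - r • 1) * (A - r • 1)) := by
    have h : (A - r • 1 : Matrix (Fin p) (Fin p) ℝ)
        = (2 * r)⁻¹ • ((A - r • 1) * ((2 * r) • 1)) := by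
      rw [Matrix.mul_smul, smul_smul, inv_mul_cancel₀ (by positivity), one_smul, Matrix.mul_one]
    rw [e1]
    conv_lhs => lhs; rw [h]
    rw [← smul_sub, ← Matrix.mul_sub, neg_smul, ← smul_neg, ← Matrix.mul_neg]
    congr 2
    rw [two_mul, add_smul]
    abel
  have e3 : upVec (A - r • 1) - upVec ((2 * r)⁻¹ • (W - r ^ 2 • 1))
      = upVec ((A - r • 1) - (2 * r)⁻¹ • (W - r ^ 2 • 1)) := by
    ext α; simp only [PiLp.sub_apply, upVec_apply, Matrix.sub_apply]
  have b1 : r ^ 2 * sqNorm (A - r • 1) ≤ sqNorm (W - r ^ 2 • 1) := by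
    rw [e1]; exact hA.sq_mul_sqNorm_le _ hr.le
  have b2 : sqNorm (A - r • 1) ≤ sqNorm (W - r ^ 2 • 1) / r ^ 2 := by
    rw [le_div_iff₀ (by positivity)]; linarith
  have b3 := sqNorm_mul_le (A - r • 1) (A - r • 1)
  have n1 := sqNorm_nonneg (A - r • 1)
  have n2 := sqNorm_nonneg (W - r ^ 2 • 1)
  rw [e3, e2]
  refine abs_le_of_sq_le_sq' ?_ (by positivity) |>.2
  refine (norm_upVec_sq_le _).trans ?_
  rw [sqNorm_smul]
  calc (-(2 * r)⁻¹) ^ 2 * sqNorm ((A - r • 1) * (A - r • 1))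
      ≤ (-(2 * r)⁻¹) ^ 2 * ((sqNorm (W - r ^ 2 • 1) / r ^ 2) * (sqNorm (W - r ^ 2 • 1) / r ^ 2)) := by
        gcongr
        exact b3.trans (mul_le_mul b2 b2 n1 (by positivity))
    _ = (sqNorm (W - r ^ 2 • 1) / (2 * r ^ 3)) ^ 2 := by
        field_simp

end MatrixSqrt

/-! ### Measurability of the square root and of the vectorization. -/

section Measurability

variable {p : ℕ}

instance matrixBorelSpace : BorelSpace (Matrix (Fin p) (Fin p) ℝ) :=
  inferInstanceAs (BorelSpace (Fin p → Fin p → ℝ))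

open scoped Matrix.Norms.L2Operator in
theorem continuousOn_matrix_sqrt :
    ContinuousOn (CFC.sqrt : Matrix (Fin p) (Fin p) ℝ → _) {A | 0 ≤ A} :=
  CFC.continuousOn_sqrt

theorem isClosed_matrix_nonneg : IsClosed {A : Matrix (Fin p) (Fin p) ℝ | 0 ≤ A} := by
  have : {A : Matrix (Fin p) (Fin p) ℝ | 0 ≤ A} = {A | A.transpose = A} ∩
      ⋂ x : Fin p → ℝ, {A | 0 ≤ x ⬝ᵥ A.mulVec x} := by
    ext A
    simp [Matrix.nonneg_iff_posSemidef, Matrix.posSemidef_iff_dotProduct_mulVec, Matrix.IsHermitian]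
  rw [this]
  refine (isClosed_eq (by fun_prop) (by fun_prop)).inter (isClosed_iInter fun x ↦ ?_)
  exact isClosed_le (by fun_prop) (by fun_prop)

/-- `CFC.sqrt` is continuous on the closed cone of positive semidefinite matrices and takes the
default value `0` off it. -/
theorem measurable_matrix_sqrt : Measurable (CFC.sqrt : Matrix (Fin p) (Fin p) ℝ → _) := by
  classical
  have : (CFC.sqrt : Matrix (Fin p) (Fin p) ℝ → _)
      = Set.piecewise {A | 0 ≤ A} CFC.sqrt fun _ ↦ 0 := by
    ext1 A
    by_cases h : 0 ≤ A
    · simp [Set.piecewise, h]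
    · simp [Set.piecewise, h, CFC.sqrt_of_not_nonneg]
  rw [this]
  exact continuousOn_matrix_sqrt.measurable_piecewise continuousOn_const
    isClosed_matrix_nonneg.measurableSet

theorem measurable_upVec : Measurable (upVec : Matrix (Fin p) (Fin p) ℝ → _) := by
  have : Continuous (upVec : Matrix (Fin p) (Fin p) ℝ → _) := by
    have : (upVec : Matrix (Fin p) (Fin p) ℝ → _) =
        fun G ↦ WithLp.toLp 2 fun α : UpIndex p ↦ G α.row α.col := by
      ext G α; exact upVec_apply G α
    rw [this]
    fun_prop
  exact this.measurable

end Measurability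

/-! ### Realizing both laws on Gaussian product spaces. -/

section Laws

variable {p m : ℕ}

/-- The Gram matrix `∑ i, X i (X i)ᵀ`, with the rows of `X` indexed by the sample. -/
def gramMatrix (x : Fin m × Fin p → ℝ) : Matrix (Fin p) (Fin p) ℝ :=
  fun a b ↦ ∑ i, x (i, a) * x (i, b)

theorem measurable_gramMatrix :
    Measurable (gramMatrix : (Fin m × Fin p → ℝ) → Matrix (Fin p) (Fin p) ℝ) := by
  have : Continuous (gramMatrix : (Fin m × Fin p → ℝ) → Matrix (Fin p) (Fin p) ℝ) :=
    continuous_matrix fun a b ↦ by unfold gramMatrix; fun_prop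
  exact this.measurable

theorem gramMatrix_sub (x : Fin m × Fin p → ℝ) :
    gramMatrix x - √(m : ℝ) ^ 2 • 1 = centeredGram x := by
  ext a b
  simp [gramMatrix, centeredGram, Matrix.one_apply]

theorem posSemidef_gramMatrix (x : Fin m × Fin p → ℝ) : (gramMatrix x).PosSemidef := by
  have : gramMatrix x = ((Matrix.of fun i a ↦ x (i, a)).conjTranspose *
      (Matrix.of fun i a ↦ x (i, a)) : Matrix (Fin p) (Fin p) ℝ) := by
    ext a b; simp [gramMatrix, Matrix.mul_apply]
  rw [this]
  exact Matrix.posSemidef_conjTranspose_mul_self _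

/-- Currying turns the product over pairs `(i, a)` into a product over samples of standard Gaussian
vectors, which are the rows in the Wishart definition. -/
theorem hasLaw_gramMatrix :
    HasLaw gramMatrix (stdWishartLaw p m) (gaussianPi (Fin m × Fin p)) where
  aemeasurable := measurable_gramMatrix.aemeasurable
  map_eq := by
    have hm : Measurable fun X : Fin m → EuclideanSpace ℝ (Fin p) ↦
        ∑ i, Matrix.vecMulVec (X i).ofLp (X i).ofLp := by
      have : Continuous fun X : Fin m → EuclideanSpace ℝ (Fin p) ↦
          ∑ i, Matrix.vecMulVec (X i).ofLp (X i).ofLp :=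
        continuous_matrix fun a b ↦ by
          simp only [Matrix.sum_apply, Matrix.vecMulVec_apply]
          fun_prop
      exact this.measurable
    have hc : (gaussianPi (Fin m × Fin p)).map (MeasurableEquiv.curry (Fin m) (Fin p) ℝ)
        = Measure.pi fun _ : Fin m ↦ gaussianPi (Fin p) := by
      have := Measure.infinitePi_map_curry (ι := Fin m) (κ := Fin p)
        (fun _ _ ↦ gaussianReal 0 1)
      simp only [Measure.infinitePi_eq_pi] at this
      exact this
    have hpi : (Measure.pi fun _ : Fin m ↦ gaussianPi (Fin p)).map
        (fun X i ↦ (WithLp.toLp 2 (X i) : EuclideanSpace ℝ (Fin p)))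
        = Measure.pi fun _ : Fin m ↦ stdGaussian (EuclideanSpace ℝ (Fin p)) := by
      have hstd : (gaussianPi (Fin p)).map (WithLp.toLp 2)
          = stdGaussian (EuclideanSpace ℝ (Fin p)) := map_pi_eq_stdGaussian
      have : ∀ _i : Fin m, SigmaFinite ((gaussianPi (Fin p)).map
          (WithLp.toLp 2 : (Fin p → ℝ) → EuclideanSpace ℝ (Fin p))) := fun _ ↦ by
        rw [hstd]; infer_instance
      rw [Measure.pi_map_pi (hμ := this) fun _ ↦ by fun_prop]
      simp only [hstd]
    unfold stdWishartLaw wishartLaw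
    simp only [multivariateGaussian_zero_one]
    have hL : Measurable fun (X : Fin m → Fin p → ℝ) i ↦
        (WithLp.toLp 2 (X i) : EuclideanSpace ℝ (Fin p)) := by fun_prop
    have hC : Measurable (MeasurableEquiv.curry (Fin m) (Fin p) ℝ) :=
      (MeasurableEquiv.curry (Fin m) (Fin p) ℝ).measurable
    rw [← hpi, ← hc, Measure.map_map hL hC, Measure.map_map hm (hL.comp hC)]
    congr 1
    ext x a b
    simp only [Function.comp_apply, Matrix.sum_apply, Matrix.vecMulVec_apply]
    rfl

theorem limitCov_eq_diagonal : limitCov p = Matrix.diagonal fun α ↦ limitScale p α ^ 2 := by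
  ext α β
  simp only [limitScale_sq]
  rcases α with a | a <;> rcases β with b | b <;>
    simp [limitCov, Matrix.one_apply, Matrix.diagonal_apply]

theorem sqrt_limitCov : CFC.sqrt (limitCov p) = Matrix.diagonal (limitScale p) := by
  refine CFC.sqrt_unique ?_ ?_
  · rw [limitCov_eq_diagonal, Matrix.diagonal_mul_diagonal]
    simp only [pow_two]
  · rw [Matrix.nonneg_iff_posSemidef, Matrix.posSemidef_diagonal_iff]
    exact fun α ↦ (limitScale_pos α).le

theorem hasLaw_scaleVec_limitScale :
    HasLaw (scaleVec (limitScale p)) (multivariateGaussian 0 (limitCov p))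
      (gaussianPi (UpIndex p)) where
  aemeasurable := (continuous_scaleVec _).aemeasurable
  map_eq := by
    have hstd : (gaussianPi (UpIndex p)).map (WithLp.toLp 2)
        = stdGaussian (EuclideanSpace ℝ (UpIndex p)) := map_pi_eq_stdGaussian
    unfold multivariateGaussian
    rw [sqrt_limitCov, ← hstd, Measure.map_map (by fun_prop) (by fun_prop)]
    congr 1
    ext z α
    simp [scaleVec, Matrix.toEuclideanCLM_toLp, Matrix.mulVec_diagonal]

end Laws

/-! ### Assembling the quantitative estimate. -/

section Comparison

variable {p m : ℕ}

/-- The normalized square root `(W^{1/2} - √m I)_up`. -/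
noncomputable def sqrtVec (p m : ℕ) (A : Matrix (Fin p) (Fin p) ℝ) : EuclideanSpace ℝ (UpIndex p) :=
  upVec (CFC.sqrt A - √(m : ℝ) • 1)

theorem measurable_sqrtVec : Measurable (sqrtVec p m) :=
  measurable_upVec.comp (measurable_matrix_sqrt.sub_const _)

theorem norm_sqrtVec_sub_wishartLin_le (hm : m ≠ 0) (x : Fin m × Fin p → ℝ) :
    ‖sqrtVec p m (gramMatrix x) - wishartLin x‖ ≤ sqNorm (centeredGram x) / (2 * √(m : ℝ) ^ 3) := by
  have hr : 0 < √(m : ℝ) := Real.sqrt_pos.2 (by exact_mod_cast Nat.pos_of_ne_zero hm)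
  have := (posSemidef_gramMatrix x).norm_upVec_sqrt_sub_le hr
  rwa [gramMatrix_sub] at this

theorem integrable_sqNorm_centeredGram :
    Integrable (fun x : Fin m × Fin p → ℝ ↦ sqNorm (centeredGram x)) (gaussianPi _) :=
  integrable_finsetSum _ fun a _ ↦ integrable_finsetSum _ fun b _ ↦ integrable_centeredGram_sq a b

theorem integral_sqNorm_centeredGram_le :
    ∫ x, sqNorm (centeredGram x) ∂gaussianPi (Fin m × Fin p) ≤ 2 * m * (p : ℝ) ^ 2 := by
  unfold sqNorm
  rw [integral_finsetSum _ fun a _ ↦ integrable_finsetSum _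
    fun b _ ↦ integrable_centeredGram_sq a b]
  calc _ = ∑ a : Fin p, ∑ b : Fin p, ∫ x, centeredGram x a b ^ 2 ∂gaussianPi (Fin m × Fin p) :=
        Finset.sum_congr rfl fun a _ ↦ integral_finsetSum _ fun b _ ↦ integrable_centeredGram_sq a b
    _ ≤ ∑ a : Fin p, ∑ b : Fin p, 2 * (m : ℝ) :=
        Finset.sum_le_sum fun a _ ↦ Finset.sum_le_sum fun b _ ↦ integral_centeredGram_sq_le a b
    _ = _ := by simp; ring

/-- The distance to the integrable linearization is dominated by an integrable quadratic quantity.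
-/
theorem integrable_sqrtVec_gramMatrix (hm : m ≠ 0) :
    Integrable (fun x ↦ sqrtVec p m (gramMatrix x)) (gaussianPi (Fin m × Fin p)) := by
  have h : Integrable (fun x ↦ sqrtVec p m (gramMatrix x) - wishartLin x)
      (gaussianPi (Fin m × Fin p)) :=
    (integrable_sqNorm_centeredGram.div_const (2 * √(m : ℝ) ^ 3)).mono'
      ((measurable_sqrtVec.comp measurable_gramMatrix).sub
        continuous_wishartLin.measurable).aestronglyMeasurable
      (ae_of_all _ fun x ↦ norm_sqrtVec_sub_wishartLin_le hm x)
  refine (h.add integrable_wishartLin).congr (ae_of_all _ fun x ↦ ?_)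
  simp

theorem abs_integral_sqrtVec_sub_le (hp : p ≠ 0) (hm : m ≠ 0) {h : EuclideanSpace ℝ (UpIndex p) → ℝ}
    (hh : LipschitzWith 1 h) :
    |∫ x, h (sqrtVec p m (gramMatrix x)) ∂gaussianPi (Fin m × Fin p)
        - ∫ z, h (scaleVec (limitScale p) z) ∂gaussianPi (UpIndex p)|
      ≤ ((p : ℝ) ^ 2 + 3 * ((p : ℝ) ^ 2 * √p)) / √m := by
  have hm' : (0 : ℝ) < m := by exact_mod_cast Nat.pos_of_ne_zero hm
  have hp' : (0 : ℝ) < p := by exact_mod_cast Nat.pos_of_ne_zero hp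
  have hr : 0 < √(m : ℝ) := Real.sqrt_pos.2 hm'
  have hs : 0 < √(p : ℝ) := Real.sqrt_pos.2 hp'
  have hr2 : √(m : ℝ) ^ 2 = m := Real.sq_sqrt hm'.le
  have hs2 : √(p : ℝ) ^ 2 = p := Real.sq_sqrt hp'.le
  set r := √(m : ℝ)
  set s := √(p : ℝ)
  have e1 : |∫ x, h (sqrtVec p m (gramMatrix x)) ∂gaussianPi (Fin m × Fin p)
      - ∫ x, h (wishartLin x) ∂gaussianPi (Fin m × Fin p)| ≤ (p : ℝ) ^ 2 / r := by
    rw [← integral_sub (hh.integrable_comp_of_integrable (integrable_sqrtVec_gramMatrix hm))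
      (hh.integrable_comp_of_integrable integrable_wishartLin), ← Real.norm_eq_abs]
    refine (norm_integral_le_of_norm_le
      (integrable_sqNorm_centeredGram.div_const (2 * r ^ 3)) (ae_of_all _ fun x ↦ ?_)).trans ?_
    · have := hh.dist_le_mul (sqrtVec p m (gramMatrix x)) (wishartLin x)
      rw [NNReal.coe_one, one_mul, dist_eq_norm, dist_eq_norm] at this
      exact this.trans (norm_sqrtVec_sub_wishartLin_le hm x)
    · rw [integral_div]
      calc _ ≤ 2 * m * (p : ℝ) ^ 2 / (2 * r ^ 3) := by
            gcongr; exact integral_sqNorm_centeredGram_le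
        _ = (p : ℝ) ^ 2 / r := by rw [← hr2]; field_simp
  -- This weight brings both terms to the order `p² √p / √m`: the discrepancy contributes `1` and
  -- the inverse covariance `2`, which makes `3` after bounding `π/2` by `2`.
  have hl : 0 < 2 * r / s := by positivity
  have e2 := isSteinKernel_wishartKernel.abs_integral_sub_le hh (fun b ↦ (limitScale_pos b).ne')
    (integrable_wishartKernel_sub_sq hm) hl
  have e3 : (2 * r / s * steinDiscrepancy (gaussianPi (Fin m × Fin p)) wishartKernel (limitScale p)
      + (2 * r / s)⁻¹ * ∑ b, (limitScale p b ^ 2)⁻¹) / 2 * (Real.pi / 2)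
      ≤ 3 * ((p : ℝ) ^ 2 * s) / r := by
    have h4 : Real.pi / 2 ≤ 2 := by linarith [Real.pi_le_four]
    calc _ ≤ (2 * r / s * ((p : ℝ) ^ 3 / (2 * m)) + (2 * r / s)⁻¹ * (4 * (p : ℝ) ^ 2)) / 2 * 2 := by
          gcongr
          · exact steinDiscrepancy_wishartKernel_le hm
          · exact sum_inv_limitScale_sq_le
      _ = 3 * ((p : ℝ) ^ 2 * s) / r := by
          rw [← hr2, ← hs2]
          field_simp
          ring
  have e4 := abs_sub_le (∫ x, h (sqrtVec p m (gramMatrix x)) ∂gaussianPi (Fin m × Fin p))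
    (∫ x, h (wishartLin x) ∂gaussianPi (Fin m × Fin p))
    (∫ z, h (scaleVec (limitScale p) z) ∂gaussianPi (UpIndex p))
  rw [add_div]
  linarith [e2.trans e3]

theorem rpow_five_halves (p : ℕ) : (p : ℝ) ^ (5 / 2 : ℝ) = (p : ℝ) ^ 2 * √p := by
  rw [Real.sqrt_eq_rpow, ← Real.rpow_natCast,
    ← Real.rpow_add_of_nonneg (Nat.cast_nonneg p) (by norm_num) (by norm_num)]
  norm_num

theorem lt_rateBound (hp : p ≠ 0) (hm : m ≠ 0) :
    ((p : ℝ) ^ 2 + 3 * ((p : ℝ) ^ 2 * √p)) / √m < rateBound p m := by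
  have hm' : (0 : ℝ) < m := by exact_mod_cast Nat.pos_of_ne_zero hm
  have hp' : (0 : ℝ) < p := by exact_mod_cast Nat.pos_of_ne_zero hp
  have hr : 0 < √(m : ℝ) := Real.sqrt_pos.2 hm'
  rw [rateBound, rpow_five_halves, div_eq_inv_mul, one_div]
  refine mul_lt_mul_of_pos_left ?_ (inv_pos.2 hr)
  have h1 : 0 < (p : ℝ) ^ (9 / 4 : ℝ) := by positivity
  have h2 : 0 < (p : ℝ) ^ (3 / 2 : ℝ) := by positivity
  have h3 : 0 < (p : ℝ) ^ (5 / 4 : ℝ) := by positivity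
  have h4 : 0 < (p : ℝ) ^ 2 * √p := by positivity
  have h5 : 0 < (p : ℝ) ^ 2 := by positivity
  linarith

/-- For `p ≥ 1` every power is at most `p^{5/2}`, and `215 = 42 + 9 + 18 + 75 + 15 + 56`. -/
theorem rateBound_le (hp : 1 ≤ p) :
    rateBound p m ≤ 215 * ((p : ℝ) ^ (5 / 2 : ℝ) / √(m : ℝ)) := by
  have hp' : (1 : ℝ) ≤ p := by exact_mod_cast hp
  have h : ∀ y : ℝ, y ≤ 5 / 2 → (p : ℝ) ^ y ≤ (p : ℝ) ^ (5 / 2 : ℝ) := fun y hy ↦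
    Real.rpow_le_rpow_of_exponent_le hp' hy
  have h1 := h (9 / 4) (by norm_num)
  have h2 := h (3 / 2) (by norm_num)
  have h3 := h (5 / 4) (by norm_num)
  have h4 := h 2 (by norm_num)
  have h5 := h 1 (by norm_num)
  rw [Real.rpow_two] at h4
  rw [Real.rpow_one] at h5
  rw [rateBound, one_div, mul_div_assoc', div_eq_inv_mul (215 * _)]
  refine mul_le_mul_of_nonneg_left ?_ (inv_nonneg.2 (Real.sqrt_nonneg _))
  linarith

end Comparison

/-! ### The main theorem. -/

theorem mainTheorem3 :
    (∀ (p m : ℕ), 1 ≤ p → 2 * p ≤ m →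
      ∀ {Ω Ω' : Type*} [MeasurableSpace Ω] [MeasurableSpace Ω']
        (P : Measure Ω) [IsProbabilityMeasure P] (P' : Measure Ω') [IsProbabilityMeasure P']
        (W : Ω → Matrix (Fin p) (Fin p) ℝ) (Z' : Ω' → EuclideanSpace ℝ (UpIndex p)),
        HasLaw W (stdWishartLaw p m) P →
        HasLaw Z' (multivariateGaussian 0 (limitCov p)) P' →
        Integrable (fun ω ↦ upVec (CFC.sqrt (W ω) - √(m : ℝ) • 1)) P ∧
        Integrable Z' P' ∧
        wassersteinDist P (fun ω ↦ upVec (CFC.sqrt (W ω) - √(m : ℝ) • 1)) P' Z'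
          < ENNReal.ofReal (rateBound p m)) ∧
    ∃ C : ℝ, 0 < C ∧ ∀ (p m : ℕ), 1 ≤ p → 2 * p ≤ m →
      rateBound p m ≤ C * ((p : ℝ) ^ (5 / 2 : ℝ) / √(m : ℝ)) := by
  refine ⟨fun p m hp hpm Ω Ω' _ _ P _ P' _ W Z' hW hZ ↦ ?_, 215, by norm_num,
    fun p m hp _ ↦ rateBound_le hp⟩
  have hp0 : p ≠ 0 := by omega
  have hm0 : m ≠ 0 := by omega
  have hΨ := measurable_sqrtVec (p := p) (m := m)
  have hint : Integrable (sqrtVec p m) (stdWishartLaw p m) := by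
    rw [← (hasLaw_gramMatrix (p := p) (m := m)).map_eq]
    exact (integrable_map_measure hΨ.aestronglyMeasurable hasLaw_gramMatrix.aemeasurable).2
      (integrable_sqrtVec_gramMatrix hm0)
  have hW' : Integrable (fun ω ↦ sqrtVec p m (W ω)) P := by
    rw [← hW.map_eq] at hint
    exact hint.comp_aemeasurable hW.aemeasurable
  have hZ' : Integrable Z' P' := by
    have h : Integrable id (P'.map Z') := by
      rw [hZ.map_eq]; exact IsGaussian.integrable_id
    exact h.comp_aemeasurable hZ.aemeasurable
  refine ⟨hW', hZ', ?_⟩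
  -- A supremum inherits only a non-strict bound, so strictness comes from an intermediate constant,
  -- uniform in `h`.
  refine lt_of_le_of_lt (b := ENNReal.ofReal
    (((p : ℝ) ^ 2 + 3 * ((p : ℝ) ^ 2 * √p)) / √m)) (iSup₂_le fun h hh ↦ ?_)
    ((ENNReal.ofReal_lt_ofReal_iff_of_nonneg (by positivity)).2 (lt_rateBound hp0 hm0))
  refine ENNReal.ofReal_le_ofReal ?_
  have m1 : Measurable fun A ↦ h (sqrtVec p m A) := hh.continuous.measurable.comp hΨ
  have eW : ∫ ω, h (sqrtVec p m (W ω)) ∂P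
      = ∫ x, h (sqrtVec p m (gramMatrix x)) ∂gaussianPi (Fin m × Fin p) :=
    (hW.integral_comp m1.aestronglyMeasurable).trans
      (hasLaw_gramMatrix.integral_comp m1.aestronglyMeasurable).symm
  have eZ : ∫ ω, h (Z' ω) ∂P' = ∫ z, h (scaleVec (limitScale p) z) ∂gaussianPi (UpIndex p) :=
    (hZ.integral_comp hh.continuous.aestronglyMeasurable).trans
      (hasLaw_scaleVec_limitScale.integral_comp hh.continuous.aestronglyMeasurable).symm
  change |∫ ω, h (sqrtVec p m (W ω)) ∂P - ∫ ω, h (Z' ω) ∂P'| ≤ _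
  rw [eW, eZ]
  exact abs_integral_sqrtVec_sub_le hp0 hm0 hh
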